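/- All graphs are finite and simple. A cactus is a connected graph each of whose blocks is an edge or a cycle, and $Cact(n,t)$ is the set of cacti with $n$ vertices and exactly $t$ cycles. For a connected graph $G$, let $d(u)$ be the degree of $u$ and $R(u,v)$ the resistance distance, i.e. the effective resistance between $u$ and $v$ when every edge is a unit resistor. The degree resistance distance of $G$ is $$D_R(G)=\sum_{\{u,v\}\subseteq V(G)}[d(u)+d(v)]\,R(u,v).$$ Let $G^0(n,t)$ be the graph consisting of $t$ triangles and $n-2t-1$ pendent edges which all share one common vertex and are otherwise disjoint. For $t\ge 1$ and $n\ge 2t+2$, let $G_5$ be the graph consisting of one $4$-cycle, $t-1$ triangles and $n-2t-2$ pendent edges which all share one common vertex and are otherwise disjoint; equivalently, $G_5$ arises from $G^0(n,t)$ by replacing a triangle together with one pendent edge at the common vertex by a $4$-cycle through that vertex. **Theorem 4.1.** Let $n\ge 7$, $t\ge 1$ and $n\ge 2t+2$. Among all graphs in $Cact(n,t)$, the cactus with the second-minimum degree resistance distance is $G_5$. That is, $G^0(n,t),G_5\in Cact(n,t)$, $D_R(G^0(n,t))<D_R(G_5)$, and every $G\in Cact(n,t)$ not isomorphic to $G^0(n,t)$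 satisfies $D_R(G)\ge D_R(G_5)$, with equality if and only if $G\cong G_5$. -/

import Mathlib

namespace CactusResistance

/-- A subgraph is nonseparable if it is connected and has no cut vertex: deleting any one
of its vertices leaves a graph that is connected or empty. -/
def IsNonseparable {V : Type*} {G : SimpleGraph V} (H : G.Subgraph) : Prop :=
  H.Connected ∧ ∀ v ∈ H.verts, (H.deleteVerts {v}).Preconnected

/-- The blocks of a graph are its maximal connected subgraphs without cut vertex. -/
def IsBlock {V : Type*} {G : SimpleGraph V} (B : G.Subgraph) : Prop :=
  Maximal (fun H : G.Subgraph => IsNonseparable H) B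

/-- The subgraph consists of one edge of the graph and its two end points. -/
def IsEdgeSubgraph {V : Type*} {G : SimpleGraph V} (H : G.Subgraph) : Prop :=
  ∃ (u v : V) (h : G.Adj u v), H = G.subgraphOfAdj h

/-- The subgraph is a cycle. -/
def IsCycleSubgraph {V : Type*} {G : SimpleGraph V} (H : G.Subgraph) : Prop :=
  ∃ (v : V) (p : G.Walk v v), p.IsCycle ∧ H = p.toSubgraph

/-- A cactus: a connected graph each of whose blocks is an edge or a cycle. -/
def IsCactus {V : Type*} (G : SimpleGraph V) : Prop :=
  G.Connected ∧ ∀ B : G.Subgraph, IsBlock B → IsEdgeSubgraph B ∨ IsCycleSubgraph B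

/-- The number of cycles of a graph, a cycle being counted as a subgraph (that is, without
a starting point or a direction). -/
noncomputable def numCycles {V : Type*} (G : SimpleGraph V) : ℕ :=
  {C : G.Subgraph | IsCycleSubgraph C}.ncard

/-- The cacti with `n` vertices (labelled by `Fin n`) and `t` cycles. -/
def Cact (n t : ℕ) : Set (SimpleGraph (Fin n)) :=
  {G | IsCactus G ∧ numCycles G = t}

open Classical in
/-- Every edge is a unit resistor. By Ohm's and Kirchhoff's laws, `f` is a potential for a
unit current that enters the network at `u` and leaves it at `v` when, at every vertex `w`, the
net outgoing current `∑ x ~ w, (f w - f x)`, which is the entry at `w` of the Laplacian applied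
to `f`, equals the external current fed in at `w`. -/
def IsUnitPotential {V : Type*} [Fintype V] (G : SimpleGraph V) (u v : V) (f : V → ℝ) : Prop :=
  (G.lapMatrix ℝ).mulVec f = Pi.single u 1 - Pi.single v 1

/-- In a connected graph a potential as above exists. -/
theorem exists_isUnitPotential {V : Type*} [Fintype V] {G : SimpleGraph V}
    (hG : G.Connected) (u v : V) : ∃ f : V → ℝ, IsUnitPotential G u v f := by
  classical
  have hsym : (Matrix.toEuclideanLin (G.lapMatrix ℝ)).IsSymmetric :=
    Matrix.isSymmetric_toEuclideanLin_iff.2 (SimpleGraph.isSymm_lapMatrix G (R := ℝ))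
  have hk := hsym.orthogonal_range
  have hfin : (LinearMap.range (Matrix.toEuclideanLin (G.lapMatrix ℝ)))ᗮᗮ =
      LinearMap.range (Matrix.toEuclideanLin (G.lapMatrix ℝ)) :=
    Submodule.orthogonal_orthogonal _
  have h : WithLp.toLp 2 (Pi.single u 1 - Pi.single v 1 : V → ℝ) ∈
      LinearMap.range (Matrix.toEuclideanLin (G.lapMatrix ℝ)) := by
    rw [← hfin, hk, Submodule.mem_orthogonal]
    intro x hx
    have hx' : (G.lapMatrix ℝ).mulVec x.ofLp = 0 := by
      have := LinearMap.mem_ker.1 hx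
      simpa [Matrix.toLpLin_apply] using this
    have h1 := (G.lapMatrix_mulVec_eq_zero_iff_forall_reachable).1 hx' u v
      (hG.preconnected u v)
    simp [PiLp.inner_apply, sub_mul, Finset.sum_sub_distrib, h1]
  obtain ⟨f, hf⟩ := h
  refine ⟨f.ofLp, ?_⟩
  unfold IsUnitPotential
  have := congrArg WithLp.ofLp hf
  simp only [Matrix.toLpLin_apply] at this
  convert this

open Classical in
/-- Resistance distance: the potential difference between `u` and `v` when a unit current
flows from `u` to `v`. In a connected graph such a potential exists and the difference does
not depend on its choice; the value `0` is used when there is no such potential. -/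
noncomputable def resistance {V : Type*} [Fintype V] (G : SimpleGraph V) (u v : V) : ℝ :=
  if h : ∃ f : V → ℝ, IsUnitPotential G u v f then h.choose u - h.choose v else 0

/-- The resistance distance does not depend on the choice of the potential. -/
theorem IsUnitPotential.resistance_eq {V : Type*} [Fintype V] {G : SimpleGraph V}
    (hG : G.Connected) {u v : V} {f : V → ℝ} (hf : IsUnitPotential G u v f) :
    resistance G u v = f u - f v := by
  classical
  have h : ∃ f : V → ℝ, IsUnitPotential G u v f := ⟨f, hf⟩
  have hg := h.choose_spec
  rw [resistance, dif_pos h]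
  generalize h.choose = g at hg
  unfold IsUnitPotential at hf hg
  have h0 : (G.lapMatrix ℝ).mulVec (g - f) = 0 := by
    rw [Matrix.mulVec_sub, sub_eq_zero]
    convert hg.trans hf.symm
  have h1 := (G.lapMatrix_mulVec_eq_zero_iff_forall_reachable).1 h0 u v (hG.preconnected u v)
  simp only [Pi.sub_apply] at h1
  linarith

open Classical in
/-- The degree resistance distance, the sum of `[d(u) + d(v)] R(u,v)` over the unordered pairs
of vertices. Every such pair occurs twice in the double sum, and the diagonal terms are `0`. -/
noncomputable def degreeResistanceDistance {V : Type*} [Fintype V] (G : SimpleGraph V) : ℝ :=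
  (∑ u : V, ∑ v : V, ((G.degree u : ℝ) + (G.degree v : ℝ)) * resistance G u v) / 2

/-- The graph `G⁰(n,t)`, for `2 * t + 1 ≤ n`: the vertex `0` is joined to all other vertices,
and the edges `{1,2}, {3,4}, …, {2t-1,2t}` are added. So it consists of `t` triangles and
`n - 2t - 1` pendent edges with the common vertex `0`. -/
def minGraph (n t : ℕ) : SimpleGraph (Fin n) :=
  SimpleGraph.fromRel fun i j =>
    i.val = 0 ∨ (i.val % 2 = 1 ∧ j.val = i.val + 1 ∧ j.val ≤ 2 * t)

/-- The graph `G₅`, for `1 ≤ t` and `2 * t + 2 ≤ n`: in `G⁰(n,t)` the triangle `0, 2t-1, 2t`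
with the pendent edge `{0, 2t+1}` is replaced by the 4-cycle `0, 2t-1, 2t, 2t+1`. So it consists
of one 4-cycle, `t - 1` triangles and `n - 2t - 2` pendent edges with the common vertex `0`. -/
def secondMinGraph (n t : ℕ) : SimpleGraph (Fin n) :=
  SimpleGraph.fromRel fun i j =>
    (i.val = 0 ∧ j.val ≠ 2 * t) ∨ (i.val % 2 = 1 ∧ j.val = i.val + 1 ∧ j.val ≤ 2 * t) ∨
      (i.val = 2 * t ∧ j.val = 2 * t + 1)

end CactusResistance

/-!
The degree resistance distance of a cactus splits over its blocks. For a unit current from `u` to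
`v`, Kirchhoff's law, tested against functions that are constant on the components left by deleting
the edges of a block `B`, shows that the potential restricted to `B` is a potential for a unit
current inside `B` between the projections of `u` and `v`. Summing the energies over the blocks,
`R(u, v)` is the sum of the resistances inside the blocks between the projections of `u` and `v`
(`resistance_eq_sum`), and these are explicit since every block is an edge or a cycle.

Hence the degree resistance distance is a sum of shares of the blocks
(`degreeResistanceDistance_eq_sum_share`). If `N i` vertices of total degree `D i` project to the
vertex `i` of a block, its share is `∑ i j, D i * N j * R (i - j)`. As the component behind `i` is
connected, `D i ≥ r + 2 * (N i - 1)`, where `r` is the degree inside the block, and the row sums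
of `R` are constant. So, for a given block length, the share is least for a pendent block, that is,
when everything else hangs at one vertex of the block (`BlockChart.share_eq`,
`BlockChart.corr_nonneg`).

A cactus with `n` vertices and `t` cycles has `n - 1 + t` edges (`IsCactus.ncard_edgeSet`), so the
shares may be compared with reference values whose sum depends on `n` and `t` only: `β` for a
bridge, and `τ + (k - 3) * β` for a cycle of length `k`, where `β` and `τ` are the shares of a
pendent bridge and a pendent triangle. The excess of a block over its reference value is `0` for
pendent bridges and triangles, equals `gap n t > 0` for a pendent 4-cycle, and exceeds `gap n t` in
all other cases (`BlockChart.excess_eq_zero`, `BlockChart.excess_eq_gap`,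
`BlockChart.gap_lt_excess`). Therefore a cactus either consists of pendent bridges and triangles
only, or its degree resistance distance exceeds the minimum by at least `gap n t`, with equality
exactly when it has one pendent 4-cycle and is otherwise made of pendent bridges and triangles.
Pendent blocks all hang at one common vertex (`exists_common_center`), so the graph is determined
up to isomorphism in both cases.
-/

namespace CactusResistance
open SimpleGraph

/-! ### Nonseparable subgraphs -/

section Nonseparable

variable {V : Type*} {G : SimpleGraph V}

/-- Nonseparability in terms of walks: any two vertices other than `v` are joined by a walk inside
the subgraph that avoids `v`. -/
theorem isNonseparable_iff {H : G.Subgraph} :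
    IsNonseparable H ↔ H.Connected ∧ ∀ v a b, a ∈ H.verts → b ∈ H.verts → a ≠ v → b ≠ v →
      ∃ p : G.Walk a b, p.toSubgraph ≤ H ∧ v ∉ p.support := by
  refine and_congr_right fun hc => ⟨fun h v a b ha hb hav hbv => ?_, fun h v hv => ?_⟩
  · by_cases hv : v ∈ H.verts
    · have := (Subgraph.preconnected_iff_forall_exists_walk_subgraph _).1 (h v hv)
        (u := a) (v := b) (by simp [ha, hav]) (by simp [hb, hbv])
      obtain ⟨p, hp⟩ := this
      refine ⟨p, hp.trans Subgraph.deleteVerts_le, fun hvp => ?_⟩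
      have := hp.1 ((p.mem_verts_toSubgraph).2 hvp)
      simp at this
    · obtain ⟨p, hp⟩ := ((Subgraph.connected_iff_forall_exists_walk_subgraph _).1 hc).2 ha hb
      exact ⟨p, hp, fun hvp => hv (hp.1 ((p.mem_verts_toSubgraph).2 hvp))⟩
  · rw [Subgraph.preconnected_iff_forall_exists_walk_subgraph]
    intro a b ha hb
    simp only [Subgraph.deleteVerts_verts, Set.mem_sdiff, Set.mem_singleton_iff] at ha hb
    obtain ⟨p, hp, hvp⟩ := h v a b ha.1 hb.1 ha.2 hb.2
    have hs : ∀ u ∈ p.support, u ∈ H.verts ∧ u ≠ v := fun u hu =>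
      ⟨hp.1 ((p.mem_verts_toSubgraph).2 hu), fun h => hvp (h ▸ hu)⟩
    refine ⟨p, fun u hu => ?_, fun u w huw => ?_⟩
    · simpa using hs u ((p.mem_verts_toSubgraph).1 hu)
    · have h1 := hs u ((p.mem_verts_toSubgraph).1 huw.fst_mem)
      have h2 := hs w ((p.mem_verts_toSubgraph).1 huw.snd_mem)
      simp only [Subgraph.deleteVerts_adj, Set.mem_singleton_iff]
      exact ⟨h1.1, h1.2, h2.1, h2.2, hp.2 huw⟩

/-- Two nonseparable subgraphs with two common vertices have a nonseparable union. -/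
theorem IsNonseparable.sup {H₁ H₂ : G.Subgraph} (h₁ : IsNonseparable H₁) (h₂ : IsNonseparable H₂)
    {x y : V} (hxy : x ≠ y) (hx₁ : x ∈ H₁.verts) (hx₂ : x ∈ H₂.verts) (hy₁ : y ∈ H₁.verts)
    (hy₂ : y ∈ H₂.verts) : IsNonseparable (H₁ ⊔ H₂) := by
  have h₁' := (isNonseparable_iff.1 h₁).2
  have h₂' := (isNonseparable_iff.1 h₂).2
  refine isNonseparable_iff.2 ⟨Subgraph.connected_sup h₁.1.preconnected h₂.1.preconnected ⟨x, hx₁, hx₂⟩, fun v a b ha hb hav hbv => ?_⟩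
  obtain ⟨z, hzv, hz₁, hz₂⟩ : ∃ z, z ≠ v ∧ z ∈ H₁.verts ∧ z ∈ H₂.verts := by
    by_cases hxv : x = v
    · exact ⟨y, fun h => hxy (hxv.trans h.symm), hy₁, hy₂⟩
    · exact ⟨x, hxv, hx₁, hx₂⟩
  have key : ∀ a, a ∈ (H₁ ⊔ H₂).verts → a ≠ v →
      ∃ p : G.Walk a z, p.toSubgraph ≤ H₁ ⊔ H₂ ∧ v ∉ p.support := by
    rintro a (ha | ha) hav
    · obtain ⟨p, hp, hv⟩ := h₁' v a z ha hz₁ hav hzv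
      exact ⟨p, hp.trans le_sup_left, hv⟩
    · obtain ⟨p, hp, hv⟩ := h₂' v a z ha hz₂ hav hzv
      exact ⟨p, hp.trans le_sup_right, hv⟩
  obtain ⟨p, hp, hpv⟩ := key a ha hav
  obtain ⟨q, hq, hqv⟩ := key b hb hbv
  refine ⟨p.append q.reverse, ?_, ?_⟩
  · rw [Walk.toSubgraph_append, Walk.toSubgraph_reverse]
    exact sup_le hp hq
  · rw [Walk.mem_support_append_iff, Walk.support_reverse, List.mem_reverse]
    exact not_or.2 ⟨hpv, hqv⟩

/-- Adding an ear, that is, a path between two distinct vertices of a nonseparable subgraph, keeps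
the subgraph nonseparable. The path may meet the subgraph in inner vertices. -/
theorem IsNonseparable.sup_path {H : G.Subgraph} (h : IsNonseparable H) {x y : V} (hxy : x ≠ y)
    (hx : x ∈ H.verts) (hy : y ∈ H.verts) {p : G.Walk x y} (hp : p.IsPath) :
    IsNonseparable (H ⊔ p.toSubgraph) := by
  classical
  have h' := (isNonseparable_iff.1 h).2
  refine isNonseparable_iff.2 ⟨Subgraph.connected_sup h.1.preconnected p.toSubgraph_connected.preconnected ⟨x, hx, by simp⟩,
    fun v a b ha hb hav hbv => ?_⟩
  obtain ⟨z, hzv, hz⟩ : ∃ z, z ≠ v ∧ z ∈ H.verts := by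
    by_cases hxv : x = v
    · exact ⟨y, fun h => hxy (hxv.trans h.symm), hy⟩
    · exact ⟨x, hxv, hx⟩
  have key : ∀ a, a ∈ (H ⊔ p.toSubgraph).verts → a ≠ v →
      ∃ q : G.Walk a z, q.toSubgraph ≤ H ⊔ p.toSubgraph ∧ v ∉ q.support := by
    have hH : ∀ a, a ∈ H.verts → a ≠ v →
        ∃ q : G.Walk a z, q.toSubgraph ≤ H ⊔ p.toSubgraph ∧ v ∉ q.support := by
      intro a ha hav
      obtain ⟨q, hq, hv⟩ := h' v a z ha hz hav hzv
      exact ⟨q, hq.trans le_sup_left, hv⟩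
    rintro a (ha | ha) hav
    · exact hH a ha hav
    · rw [Walk.mem_verts_toSubgraph] at ha
      have hle : (p.takeUntil a ha).toSubgraph ⊔ (p.dropUntil a ha).toSubgraph ≤ p.toSubgraph := by
        rw [← Walk.toSubgraph_append, Walk.take_spec]
      -- The path avoids `v` on one of the two sides of `a`.
      by_cases hv : v ∈ (p.takeUntil a ha).support
      · have hv2 : v ∉ (p.dropUntil a ha).support := by
          intro hv2
          have hnd := hp.support_nodup
          rw [← p.take_spec ha, Walk.support_append] at hnd
          have hd := (List.nodup_append'.1 hnd).2.2
          rw [← Walk.cons_tail_support] at hv2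
          rcases List.mem_cons.1 hv2 with h | h
          · exact hav h.symm
          · exact hd hv h
        have hyv : y ≠ v := fun h => hv2 (h ▸ Walk.end_mem_support _)
        obtain ⟨q, hq, hqv⟩ := hH y hy hyv
        refine ⟨(p.dropUntil a ha).append q, ?_, ?_⟩
        · rw [Walk.toSubgraph_append]
          exact sup_le ((le_sup_right.trans hle).trans le_sup_right) hq
        · rw [Walk.mem_support_append_iff]
          exact not_or.2 ⟨hv2, hqv⟩
      · have hxv : x ≠ v := fun h => hv (h ▸ Walk.start_mem_support _)
        obtain ⟨q, hq, hqv⟩ := hH x hx hxv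
        refine ⟨(p.takeUntil a ha).reverse.append q, ?_, ?_⟩
        · rw [Walk.toSubgraph_append, Walk.toSubgraph_reverse]
          exact sup_le ((le_sup_left.trans hle).trans le_sup_right) hq
        · rw [Walk.mem_support_append_iff, Walk.support_reverse, List.mem_reverse]
          exact not_or.2 ⟨hv, hqv⟩
  obtain ⟨p₁, hp₁, hv₁⟩ := key a ha hav
  obtain ⟨p₂, hp₂, hv₂⟩ := key b hb hbv
  refine ⟨p₁.append p₂.reverse, ?_, ?_⟩
  · rw [Walk.toSubgraph_append, Walk.toSubgraph_reverse]
    exact sup_le hp₁ hp₂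
  · rw [Walk.mem_support_append_iff, Walk.support_reverse, List.mem_reverse]
    exact not_or.2 ⟨hv₁, hv₂⟩

theorem isNonseparable_subgraphOfAdj {u w : V} (h : G.Adj u w) :
    IsNonseparable (G.subgraphOfAdj h) := by
  refine isNonseparable_iff.2 ⟨Subgraph.subgraphOfAdj_connected h, fun v a b ha hb hav hbv => ?_⟩
  have nil : ∀ a, a ∈ (G.subgraphOfAdj h).verts → a ≠ v →
      ∃ p : G.Walk a a, p.toSubgraph ≤ G.subgraphOfAdj h ∧ v ∉ p.support := by
    intro a ha hav
    refine ⟨Walk.nil, ?_, by simpa using hav.symm⟩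
    simpa [Walk.toSubgraph] using ha
  by_cases hab : a = b
  · subst hab; exact nil a ha hav
  · have hadj : (G.subgraphOfAdj h).Adj a b := by
      simp only [subgraphOfAdj_verts, Set.mem_insert_iff, Set.mem_singleton_iff] at ha hb
      rcases ha with rfl | rfl <;> rcases hb with rfl | rfl <;> simp_all [Sym2.eq_swap]
    refine ⟨hadj.adj_sub.toWalk, ?_, ?_⟩
    · rw [Adj.toSubgraph_toWalk]
      exact subgraphOfAdj_le_of_adj _ hadj
    · simp [hav.symm, hbv.symm]

theorem IsEdgeSubgraph.isNonseparable {H : G.Subgraph} (h : IsEdgeSubgraph H) :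
    IsNonseparable H := by
  obtain ⟨u, v, h, rfl⟩ := h
  exact isNonseparable_subgraphOfAdj h

theorem IsCycleSubgraph.isNonseparable {H : G.Subgraph} (h : IsCycleSubgraph H) :
    IsNonseparable H := by
  obtain ⟨v, p, hp, rfl⟩ := h
  cases p with
  | nil => exact absurd rfl hp.ne_nil
  | cons hadj q =>
    rw [Walk.cons_isCycle_iff] at hp
    have := (isNonseparable_subgraphOfAdj hadj).sup_path hadj.ne.symm (by simp) (by simp) hp.1
    simpa [Walk.toSubgraph] using this

theorem IsCycleSubgraph.ncard_neighborSet {C : G.Subgraph} (h : IsCycleSubgraph C) {v : V}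
    (hv : v ∈ C.verts) : (C.neighborSet v).ncard = 2 := by
  obtain ⟨u, p, hp, rfl⟩ := h
  exact hp.ncard_neighborSet_toSubgraph_eq_two ((p.mem_verts_toSubgraph).1 hv)

theorem IsCycleSubgraph.nonempty {C : G.Subgraph} (h : IsCycleSubgraph C) : C.verts.Nonempty := by
  obtain ⟨u, p, hp, rfl⟩ := h
  exact ⟨u, by simp⟩

theorem subgraph_eq_of_le_of_neighborSet_subset {C D : G.Subgraph} (hle : C ≤ D)
    (hD : D.Connected) (hne : C.verts.Nonempty)
    (hn : ∀ v ∈ C.verts, D.neighborSet v ⊆ C.neighborSet v) : C = D := by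
  have hverts : ∀ {a b : V} (p : G.Walk a b), p.toSubgraph ≤ D → a ∈ C.verts → b ∈ C.verts := by
    intro a b p
    induction p with
    | nil => exact fun _ h => h
    | @cons a c b h q ih =>
      intro hp ha
      have h1 : D.Adj a c := hp.2 (by simp [Walk.toSubgraph])
      exact ih (le_sup_right.trans hp) (Subgraph.Adj.snd_mem (hn a ha h1))
  obtain ⟨a, ha⟩ := hne
  have hV : D.verts ⊆ C.verts := fun b hb => by
    obtain ⟨p, hp⟩ := ((Subgraph.connected_iff_forall_exists_walk_subgraph _).1 hD).2 (hle.1 ha) hb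
    exact hverts p hp ha
  exact le_antisymm hle ⟨hV, fun u v huv => hn u (hV huv.fst_mem) huv⟩

theorem IsCycleSubgraph.eq_of_le {C D : G.Subgraph} (hC : IsCycleSubgraph C)
    (hD : IsCycleSubgraph D) (hle : C ≤ D) : C = D := by
  refine subgraph_eq_of_le_of_neighborSet_subset hle hD.isNonseparable.1 hC.nonempty fun v hv => ?_
  have h1 := hC.ncard_neighborSet hv
  have h2 := hD.ncard_neighborSet (hle.1 hv)
  have hfin : (D.neighborSet v).Finite := Set.finite_of_ncard_ne_zero (by omega)
  exact (Set.eq_of_subset_of_ncard_le (s := C.neighborSet v) (fun w hw => hle.2 hw)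
    (h2.trans h1.symm).le hfin).ge

/-- A cycle has more edges than a single edge. -/
theorem IsCycleSubgraph.not_le_edge {C E : G.Subgraph} (hC : IsCycleSubgraph C)
    (hE : IsEdgeSubgraph E) : ¬ C ≤ E := by
  intro hle
  obtain ⟨u, v, h, rfl⟩ := hE
  obtain ⟨a, ha⟩ := hC.nonempty
  have h2 := hC.ncard_neighborSet ha
  classical
  have hsub : C.neighborSet a ⊆ {if a = u then v else u} := by
    intro b hb
    have := hle.2 hb
    simp only [subgraphOfAdj_adj, Sym2.eq_iff] at this
    rcases this with ⟨rfl, rfl⟩ | ⟨rfl, rfl⟩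
    · simp
    · simp [h.ne.symm]
  have := Set.ncard_le_ncard hsub
  rw [Set.ncard_singleton] at this
  omega

/-! ### Blocks -/

theorem exists_isBlock_ge [Finite V] {H : G.Subgraph} (h : IsNonseparable H) :
    ∃ B, IsBlock B ∧ H ≤ B := by
  obtain ⟨B, hle, hB⟩ := Finite.exists_le_maximal (p := fun H : G.Subgraph => IsNonseparable H) h
  exact ⟨B, hB, hle⟩

theorem IsBlock.eq_of_mem {B₁ B₂ : G.Subgraph} (h₁ : IsBlock B₁) (h₂ : IsBlock B₂) {x y : V}
    (hxy : x ≠ y) (hx₁ : x ∈ B₁.verts) (hx₂ : x ∈ B₂.verts) (hy₁ : y ∈ B₁.verts)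
    (hy₂ : y ∈ B₂.verts) : B₁ = B₂ := by
  have h := h₁.1.sup h₂.1 hxy hx₁ hx₂ hy₁ hy₂
  exact le_antisymm (le_sup_left.trans (h₂.2 h le_sup_right))
    (le_sup_right.trans (h₁.2 h le_sup_left))

theorem IsBlock.eq_of_adj {B₁ B₂ : G.Subgraph} (h₁ : IsBlock B₁) (h₂ : IsBlock B₂) {x y : V}
    (hxy₁ : B₁.Adj x y) (hxy₂ : B₂.Adj x y) : B₁ = B₂ :=
  h₁.eq_of_mem h₂ hxy₁.adj_sub.ne hxy₁.fst_mem hxy₂.fst_mem hxy₁.snd_mem hxy₂.snd_mem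

theorem exists_isBlock_adj [Finite V] {x y : V} (h : G.Adj x y) :
    ∃ B : G.Subgraph, IsBlock B ∧ B.Adj x y := by
  obtain ⟨B, hB, hle⟩ := exists_isBlock_ge (isNonseparable_subgraphOfAdj h)
  exact ⟨B, hB, hle.2 (by simp)⟩

/-- Without the edges of a block, distinct vertices of the block are in different components. -/
theorem IsBlock.eq_of_reachable {B : G.Subgraph} (hB : IsBlock B) {x y : V} (hx : x ∈ B.verts)
    (hy : y ∈ B.verts) (h : (G \ B.spanningCoe).Reachable x y) : x = y := by
  classical
  by_contra hxy
  obtain ⟨p, hp⟩ := h.exists_isPath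
  have hle : G \ B.spanningCoe ≤ G := sdiff_le
  have hns := hB.1.sup_path hxy hx hy (hp.mapLe hle)
  have hsub := le_sup_right.trans (hB.2 hns le_sup_left)
  have hadj := p.toSubgraph_adj_snd (Walk.not_nil_of_ne hxy)
  have h1 := hsub.2 ((Walk.adj_toSubgraph_mapLe hle).2 hadj)
  exact hadj.adj_sub.2 h1

theorem exists_reachable_sdiff (hG : G.Connected) {B : G.Subgraph} (hB : B.verts.Nonempty) (v : V) :
    ∃ x ∈ B.verts, (G \ B.spanningCoe).Reachable v x := by
  obtain ⟨b, hb⟩ := hB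
  obtain ⟨p⟩ := hG.preconnected v b
  induction p with
  | nil => exact ⟨_, hb, Reachable.refl _⟩
  | @cons a c b h q ih =>
    by_cases hBadj : B.Adj a c
    · exact ⟨a, hBadj.fst_mem, Reachable.refl _⟩
    · obtain ⟨x, hx, hcx⟩ := ih hb
      have : (G \ B.spanningCoe).Adj a c := ⟨h, hBadj⟩
      exact ⟨x, hx, this.reachable.trans hcx⟩

theorem IsCactus.isBlock_of_isCycleSubgraph [Finite V] (hG : IsCactus G) {C : G.Subgraph}
    (hC : IsCycleSubgraph C) : IsBlock C := by
  obtain ⟨B, hB, hle⟩ := exists_isBlock_ge hC.isNonseparable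
  rcases hG.2 B hB with h | h
  · exact absurd hle (hC.not_le_edge h)
  · rwa [hC.eq_of_le h hle]

end Nonseparable

/-! ### The number of edges of a cactus -/

section EdgeCount

variable {V : Type*} {G : SimpleGraph V}

/-- The end points of an edge of a cycle remain connected when this edge is deleted. -/
theorem IsCycleSubgraph.reachable_of_adj {C : G.Subgraph} (hC : IsCycleSubgraph C) {u v : V}
    (h : C.Adj u v) : (C.spanningCoe \ fromEdgeSet {s(u, v)}).Reachable u v := by
  obtain ⟨w, p, hp, rfl⟩ := hC
  have hmem : ∀ e ∈ p.edges, e ∈ p.toSubgraph.spanningCoe.edgeSet := by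
    intro e he
    rw [Subgraph.edgeSet_spanningCoe, Walk.mem_edges_toSubgraph]
    exact he
  refine ((adj_and_reachable_delete_edges_iff_exists_cycle (G := p.toSubgraph.spanningCoe)).2
    ⟨w, p.transfer _ hmem, hp.transfer hmem, ?_⟩).2
  rw [Walk.edges_transfer, ← Walk.mem_edges_toSubgraph]
  exact h

/-- Deleting one edge from each cycle of a cactus leaves a spanning tree. -/
theorem IsCactus.ncard_edgeSet [Fintype V] (hG : IsCactus G) :
    G.edgeSet.ncard + 1 = Fintype.card V + numCycles G := by
  classical
  set cyc : Set G.Subgraph := {C | IsCycleSubgraph C} with hcyc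
  have hex : ∀ C : G.Subgraph, ∃ e : Sym2 V, IsCycleSubgraph C → e ∈ C.edgeSet := by
    intro C
    by_cases hC : IsCycleSubgraph C
    · obtain ⟨v, hv⟩ := hC.nonempty
      have h2 := hC.ncard_neighborSet hv
      obtain ⟨w, hw⟩ := Set.nonempty_of_ncard_ne_zero (s := C.neighborSet v) (by omega)
      exact ⟨s(v, w), fun _ => hw⟩
    · obtain ⟨v⟩ := hG.1.nonempty
      exact ⟨s(v, v), fun h => absurd h hC⟩
  choose e he using hex
  have huniq : ∀ C D : G.Subgraph, IsCycleSubgraph C → IsCycleSubgraph D → ∀ f, f ∈ C.edgeSet →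
      f ∈ D.edgeSet → C = D := by
    intro C D hC hD f
    induction f with
    | _ u v =>
      exact fun h1 h2 => (hG.isBlock_of_isCycleSubgraph hC).eq_of_adj
        (hG.isBlock_of_isCycleSubgraph hD) h1 h2
  set S : Set (Sym2 V) := e '' cyc with hS
  have hinj : Set.InjOn e cyc := fun C hC D hD h =>
    huniq C D hC hD (e C) (he C hC) (h ▸ he D hD)
  have hSG : S ⊆ G.edgeSet := by
    rintro _ ⟨C, hC, rfl⟩
    exact C.edgeSet_subset (he C hC)
  have hconn : (G.deleteEdges S).Connected := by
    have hadj : ∀ u v, G.Adj u v → (G.deleteEdges S).Reachable u v := by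
      intro u v huv
      by_cases hs : s(u, v) ∈ S
      · obtain ⟨C, hC, hCe⟩ := hs
        have hCadj : C.Adj u v := by
          have := he C hC
          rw [hCe] at this
          exact this
        refine (hC.reachable_of_adj hCadj).mono fun a b hab => ?_
        rw [deleteEdges_adj]
        refine ⟨hab.1.adj_sub, ?_⟩
        rintro ⟨D, hD, hDe⟩
        have hDab := he D hD
        rw [hDe] at hDab
        have hCD := huniq C D hC hD s(a, b) hab.1 hDab
        subst hCD
        exact hab.2 (by
          rw [fromEdgeSet_adj, Set.mem_singleton_iff, ← hDe, hCe]
          exact ⟨rfl, hab.1.adj_sub.ne⟩)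
      · have : (G.deleteEdges S).Adj u v := by rw [deleteEdges_adj]; exact ⟨huv, hs⟩
        exact this.reachable
    have := hG.1.nonempty
    refine ⟨fun u v => ?_⟩
    obtain ⟨p⟩ := hG.1.preconnected u v
    induction p with
    | nil => exact Reachable.refl _
    | cons h q ih => exact (hadj _ _ h).trans ih
  have hacyc : (G.deleteEdges S).IsAcyclic := by
    intro v q hq
    have hle : G.deleteEdges S ≤ G := deleteEdges_le S
    have hC : IsCycleSubgraph (q.mapLe hle).toSubgraph := ⟨v, _, hq.mapLe hle, rfl⟩
    have h1 := he _ hC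
    rw [Walk.mem_edges_toSubgraph, Walk.edges_mapLe_eq_edges] at h1
    have h2 := q.edges_subset_edgeSet h1
    rw [edgeSet_deleteEdges] at h2
    exact h2.2 ⟨_, hC, rfl⟩
  have htree : (G.deleteEdges S).IsTree := ⟨hconn, hacyc⟩
  have hcard := htree.card_edgeFinset
  rw [← Set.ncard_coe_finset, coe_edgeFinset, edgeSet_deleteEdges] at hcard
  have h1 := Set.ncard_sdiff_add_ncard_of_subset hSG (Set.toFinite _)
  have h2 : S.ncard = numCycles G := hinj.ncard_image
  omega

end EdgeCount

/-! ### Cyclic coordinates on a block -/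

section Chart

variable {V : Type*} {G : SimpleGraph V}

/-- A cyclic enumeration of the vertices of a subgraph that is an edge (`k = 2`) or a cycle of
length `k ≥ 3`: the neighbours of the vertex number `i` are those with the numbers `i ± 1`. -/
structure CyclicEnum (B : G.Subgraph) where
  k : ℕ
  two_le : 2 ≤ k
  x : ZMod k → V
  inj : Function.Injective x
  mem_verts : ∀ v, v ∈ B.verts ↔ ∃ i, x i = v
  adj_iff : ∀ u v, B.Adj u v ↔ ∃ i, (u = x i ∧ v = x (i + 1)) ∨ (v = x i ∧ u = x (i + 1))
  isCycle_iff : IsCycleSubgraph B ↔ 3 ≤ k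

theorem CyclicEnum.neZero {B : G.Subgraph} (E : CyclicEnum B) : NeZero E.k :=
  ⟨by have := E.two_le; omega⟩

theorem CyclicEnum.adj_x {B : G.Subgraph} (E : CyclicEnum B) (i : ZMod E.k) :
    B.Adj (E.x i) (E.x (i + 1)) := (E.adj_iff _ _).2 ⟨i, Or.inl ⟨rfl, rfl⟩⟩

theorem zmod_eq_zero_or_one_of_two (i : ZMod 2) : i = 0 ∨ i = 1 := by
  revert i; decide

theorem IsEdgeSubgraph.nonempty_cyclicEnum {B : G.Subgraph} (hB : IsEdgeSubgraph B) :
    Nonempty (CyclicEnum B) := by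
  have hnc : ¬ IsCycleSubgraph B := fun h => h.not_le_edge hB le_rfl
  obtain ⟨u, v, h, rfl⟩ := hB
  have h10 : (1 : ZMod 2) ≠ 0 := by decide
  have h11 : (1 : ZMod 2) + 1 = 0 := by decide
  refine ⟨⟨2, le_rfl, fun i => if i = 0 then u else v, ?_, ?_, ?_, ?_⟩⟩
  · intro i j hij
    rcases zmod_eq_zero_or_one_of_two i with rfl | rfl <;>
      rcases zmod_eq_zero_or_one_of_two j with rfl | rfl <;> simp [h.ne, h.ne.symm] at hij ⊢
  · intro w
    constructor
    · rintro (rfl | rfl)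
      · exact ⟨0, by simp⟩
      · exact ⟨1, by simp⟩
    · rintro ⟨i, rfl⟩
      by_cases hi : i = 0 <;> simp [hi]
  · intro a b
    rw [subgraphOfAdj_adj, Sym2.eq_iff]
    constructor
    · rintro (⟨rfl, rfl⟩ | ⟨rfl, rfl⟩)
      · exact ⟨0, by simp⟩
      · exact ⟨0, by simp⟩
    · rintro ⟨i, hi⟩
      rcases zmod_eq_zero_or_one_of_two i with rfl | rfl <;> simp [h11] at hi <;> tauto
  · simpa using hnc

theorem IsCycleSubgraph.nonempty_cyclicEnum {B : G.Subgraph} (hB : IsCycleSubgraph B) :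
    Nonempty (CyclicEnum B) := by
  have hB' := hB
  obtain ⟨v, p, hp, rfl⟩ := hB
  have h3 := hp.three_le_length
  have : NeZero p.length := ⟨by omega⟩
  have hsucc : ∀ i : ZMod p.length, p.getVert (i + 1).val = p.getVert (i.val + 1) := by
    intro i
    have h1 : (i + 1).val = (i.val + 1) % p.length := by
      rw [← ZMod.val_natCast, Nat.cast_add, ZMod.natCast_zmod_val, Nat.cast_one]
    have h2 := i.val_lt
    rcases Nat.lt_or_ge (i.val + 1) p.length with h | h
    · rw [h1, Nat.mod_eq_of_lt h]
    · have h4 : i.val + 1 = p.length := by omega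
      rw [h1, h4, Nat.mod_self, Walk.getVert_zero, Walk.getVert_length]
  refine ⟨⟨p.length, by omega, fun i => p.getVert i.val, ?_, ?_, ?_, ?_⟩⟩
  · intro i j hij
    have hi := i.val_lt
    have hj := j.val_lt
    exact ZMod.val_injective _ (hp.getVert_injOn' (by simp only [Set.mem_ofPred_eq]; omega)
      (by simp only [Set.mem_ofPred_eq]; omega) hij)
  · intro w
    rw [Walk.mem_verts_toSubgraph, Walk.mem_support_iff_exists_getVert]
    constructor
    · rintro ⟨i, rfl, hi⟩
      rcases Nat.lt_or_ge i p.length with h | h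
      · exact ⟨(i : ZMod p.length), by simp only [ZMod.val_natCast, Nat.mod_eq_of_lt h]⟩
      · have : i = p.length := by omega
        exact ⟨0, by simp [this]⟩
    · rintro ⟨i, rfl⟩
      exact ⟨i.val, rfl, i.val_lt.le⟩
  · intro a b
    rw [Walk.toSubgraph_adj_iff]
    simp only [hsucc]
    constructor
    · rintro ⟨i, hi, hlt⟩
      refine ⟨(i : ZMod p.length), ?_⟩
      rw [ZMod.val_natCast, Nat.mod_eq_of_lt hlt]
      rw [Sym2.eq_iff] at hi
      tauto
    · rintro ⟨i, hi⟩
      refine ⟨i.val, ?_, i.val_lt⟩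
      rw [Sym2.eq_iff]
      tauto
  · simpa [h3] using hB'

/-- Coordinates adapted to a block `B` of `G`: a cyclic enumeration of `B` together with the map
`proj` sending a vertex of `G` to (the number of) the vertex of `B` to which it stays connected when
the edges of `B` are deleted. -/
structure BlockChart (B : G.Subgraph) extends CyclicEnum B where
  proj : V → ZMod k
  proj_x : ∀ i, proj (x i) = i
  cross : ∀ {u v}, G.Adj u v → proj u ≠ proj v → B.Adj u v
  reach : ∀ v, (G \ B.spanningCoe).Reachable v (x (proj v))

theorem IsCactus.nonempty_blockChart (hG : IsCactus G) {B : G.Subgraph} (hB : IsBlock B) :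
    Nonempty (BlockChart B) := by
  obtain ⟨E⟩ : Nonempty (CyclicEnum B) := (hG.2 B hB).elim
    (fun h => h.nonempty_cyclicEnum) (fun h => h.nonempty_cyclicEnum)
  have hex : ∀ v, ∃ i, (G \ B.spanningCoe).Reachable v (E.x i) := by
    intro v
    obtain ⟨y, hy, hvy⟩ := exists_reachable_sdiff hG.1 (B := B)
      ⟨E.x 0, (E.mem_verts _).2 ⟨0, rfl⟩⟩ v
    obtain ⟨i, rfl⟩ := (E.mem_verts y).1 hy
    exact ⟨i, hvy⟩
  choose proj hproj using hex
  have huniq : ∀ i j, (G \ B.spanningCoe).Reachable (E.x i) (E.x j) → i = j := fun i j h =>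
    E.inj (hB.eq_of_reachable ((E.mem_verts _).2 ⟨i, rfl⟩) ((E.mem_verts _).2 ⟨j, rfl⟩) h)
  refine ⟨⟨E, proj, fun i => (huniq _ _ (hproj _)).symm, fun {u v} huv hne => ?_, hproj⟩⟩
  by_contra hB'
  have hadj : (G \ B.spanningCoe).Adj u v := ⟨huv, hB'⟩
  exact hne (huniq _ _ (((hproj u).symm.trans hadj.reachable).trans (hproj v)))

end Chart

/-! ### Resistances in a cycle -/

section Kernel

variable {k : ℕ}

/-- The effective resistance between two vertices of a cycle with `k` unit resistors whose numbers
differ by `z`: arcs of `d` and `k - d` resistors in parallel. -/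
noncomputable def cycleRes (k : ℕ) (z : ZMod k) : ℝ := z.val * (k - z.val) / k

@[simp] theorem cycleRes_zero : cycleRes k 0 = 0 := by simp [cycleRes]

variable [NeZero k]

theorem cycleRes_neg (z : ZMod k) : cycleRes k (-z) = cycleRes k z := by
  have := ZMod.neg_val z
  unfold cycleRes
  split_ifs at this with h
  · simp [h]
  · rw [this, Nat.cast_sub z.val_lt.le]
    ring

theorem val_add_one (z : ZMod k) :
    ((z + 1).val : ℝ) = z.val + 1 - if z + 1 = 0 then (k : ℝ) else 0 := by
  have h1 : (z + 1).val = (z.val + 1) % k := by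
    rw [← ZMod.val_natCast, Nat.cast_add, ZMod.natCast_zmod_val, Nat.cast_one]
  have h2 := z.val_lt
  rcases Nat.lt_or_ge (z.val + 1) k with h | h
  · rw [Nat.mod_eq_of_lt h] at h1
    have : z + 1 ≠ 0 := fun h0 => by rw [h0, ZMod.val_zero] at h1; omega
    simp [this, h1]
  · have h4 : z.val + 1 = k := by omega
    rw [h4, Nat.mod_self] at h1
    have h0 : z + 1 = 0 := (ZMod.val_eq_zero _).1 h1
    have : (z.val : ℝ) + 1 = k := by exact_mod_cast h4
    rw [if_pos h0, h1, this]
    simp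

theorem cycleRes_add_one_sub (z : ZMod k) :
    cycleRes k (z + 1) - cycleRes k z = (k - 1 - 2 * z.val) / k := by
  have hk : (k : ℝ) ≠ 0 := NeZero.ne _
  have h := val_add_one z
  unfold cycleRes
  by_cases h0 : z + 1 = 0
  · rw [if_pos h0] at h
    rw [h0, ZMod.val_zero, Nat.cast_zero] at h ⊢
    have : (z.val : ℝ) = k - 1 := by linarith
    rw [this]
    field_simp
    ring
  · rw [if_neg h0] at h
    rw [h]
    field_simp
    ring

/-- Up to a constant, `-cycleRes k / 2` is a Green's function of the Laplacian of the cycle. -/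
theorem cycleRes_second_diff (z : ZMod k) :
    2 * cycleRes k z - cycleRes k (z + 1) - cycleRes k (z - 1)
      = 2 / k - if z = 0 then 2 else 0 := by
  have hk : (k : ℝ) ≠ 0 := NeZero.ne _
  have h1 := cycleRes_add_one_sub z
  have h2 := cycleRes_add_one_sub (z - 1)
  have h3 := val_add_one (z - 1)
  rw [sub_add_cancel] at h2 h3
  have : 2 * cycleRes k z - cycleRes k (z + 1) - cycleRes k (z - 1)
      = (k - 1 - 2 * (z - 1).val) / k - (k - 1 - 2 * z.val) / k := by
    rw [← h1, ← h2]; ring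
  rw [this, h3]
  split_ifs <;> field_simp <;> ring

theorem sum_cycleRes : ∑ z : ZMod k, cycleRes k z = ((k : ℝ) ^ 2 - 1) / 6 := by
  have hk : (k : ℝ) ≠ 0 := NeZero.ne _
  have key : ∀ m : ℕ, ∑ d ∈ Finset.range m, ((d : ℝ) * (k - d) / k)
      = (m * (m - 1) / 2 * k - (m - 1) * m * (2 * m - 1) / 6) / k := by
    intro m
    induction m with
    | zero => simp
    | succ m ih =>
      rw [Finset.sum_range_succ, ih]
      push_cast
      field_simp
      ring
  have h : ∑ z : ZMod k, cycleRes k z = ∑ d ∈ Finset.range k, ((d : ℝ) * (k - d) / k) := by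
    refine Finset.sum_bij' (fun z _ => z.val) (fun d _ => (d : ZMod k)) ?_ ?_ ?_ ?_ ?_
    · intro z _; exact Finset.mem_range.2 z.val_lt
    · intro d _; exact Finset.mem_univ _
    · intro z _; exact ZMod.natCast_zmod_val z
    · intro d hd; rw [ZMod.val_natCast, Nat.mod_eq_of_lt (Finset.mem_range.1 hd)]
    · intro z _; rfl
  rw [h, key]
  field_simp
  ring

theorem sum_cycleRes_sub_left (i : ZMod k) :
    ∑ j : ZMod k, cycleRes k (i - j) = ((k : ℝ) ^ 2 - 1) / 6 := by
  rw [← sum_cycleRes]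
  exact (Equiv.subLeft i).sum_comp (cycleRes k)

theorem sum_cycleRes_sub_right (j : ZMod k) :
    ∑ i : ZMod k, cycleRes k (i - j) = ((k : ℝ) ^ 2 - 1) / 6 := by
  rw [← sum_cycleRes]
  exact (Equiv.subRight j).sum_comp (cycleRes k)

theorem le_cycleRes {z : ZMod k} (hz : z ≠ 0) : ((k : ℝ) - 1) / k ≤ cycleRes k z := by
  have hk : (0 : ℝ) < k := Nat.cast_pos.2 (NeZero.pos k)
  have h1 : 1 ≤ z.val := Nat.one_le_iff_ne_zero.2 fun h => hz ((ZMod.val_eq_zero z).1 h)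
  have h1' : (1 : ℝ) ≤ z.val := by exact_mod_cast h1
  have h2 : (z.val : ℝ) + 1 ≤ k := by exact_mod_cast z.val_lt
  unfold cycleRes
  gcongr
  nlinarith

/-- Two functions on a cycle: if `F` is a potential, in weak form, for a current `c` from `p` to
`q`, then its energy is given by the resistance of the cycle. -/
theorem energy_eq_cycleRes {F : ZMod k → ℝ} {p q : ZMod k} {c : ℝ}
    (hF : ∀ ψ : ZMod k → ℝ, ∑ i, (ψ i - ψ (i + 1)) * (F i - F (i + 1)) = c * (ψ p - ψ q)) :
    ∑ i, (F i - F (i + 1)) * (F i - F (i + 1)) = c ^ 2 * cycleRes k (p - q) := by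
  have h1 := hF (fun i => (cycleRes k (i - q) - cycleRes k (i - p)) / 2)
  have hpq : cycleRes k (q - p) = cycleRes k (p - q) := by rw [← neg_sub, cycleRes_neg]
  have hparts : ∀ h : ZMod k → ℝ, ∑ i, (h i - h (i + 1)) * (F i - F (i + 1))
      = ∑ i, (2 * h i - h (i + 1) - h (i - 1)) * F i := by
    intro h
    have hs : ∑ i, (h i - h (i + 1)) * F (i + 1) = ∑ i, (h (i - 1) - h i) * F i := by
      rw [← Equiv.sum_comp (Equiv.addRight (1 : ZMod k)) (fun i => (h (i - 1) - h i) * F i)]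
      simp
    calc _ = ∑ i, (h i - h (i + 1)) * F i - ∑ i, (h i - h (i + 1)) * F (i + 1) := by
          rw [← Finset.sum_sub_distrib]; exact Finset.sum_congr rfl fun i _ => by ring
      _ = _ := by
          rw [hs, ← Finset.sum_sub_distrib]; exact Finset.sum_congr rfl fun i _ => by ring
  have h2 : ∑ i, (2 * ((cycleRes k (i - q) - cycleRes k (i - p)) / 2)
      - (cycleRes k (i + 1 - q) - cycleRes k (i + 1 - p)) / 2
      - (cycleRes k (i - 1 - q) - cycleRes k (i - 1 - p)) / 2) * F i = F p - F q := by
    have : ∀ i, (2 * ((cycleRes k (i - q) - cycleRes k (i - p)) / 2)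
        - (cycleRes k (i + 1 - q) - cycleRes k (i + 1 - p)) / 2
        - (cycleRes k (i - 1 - q) - cycleRes k (i - 1 - p)) / 2) * F i
        = (if i = p then F i else 0) - (if i = q then F i else 0) := by
      intro i
      have e1 := cycleRes_second_diff (i - q)
      have e2 := cycleRes_second_diff (i - p)
      have s : ∀ r, i - r + 1 = i + 1 - r ∧ i - r - 1 = i - 1 - r := fun r => by
        constructor <;> ring
      simp only [(s p).1, (s p).2, (s q).1, (s q).2, sub_eq_zero] at e1 e2
      have : 2 * ((cycleRes k (i - q) - cycleRes k (i - p)) / 2)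
        - (cycleRes k (i + 1 - q) - cycleRes k (i + 1 - p)) / 2
        - (cycleRes k (i - 1 - q) - cycleRes k (i - 1 - p)) / 2
        = (if i = p then 1 else 0) - (if i = q then 1 else 0) := by
        split_ifs at e1 e2 ⊢ <;> linarith
      rw [this]
      split_ifs <;> ring
    simp_rw [this]
    simp [Finset.sum_sub_distrib]
  rw [hparts, h2] at h1
  simp only [sub_self, cycleRes_zero, hpq] at h1
  rw [hF F, h1]
  ring

end Kernel

/-! ### Decomposition of the resistance distance over the blocks -/

section Energy

open Classical

variable {V : Type*} {G : SimpleGraph V}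

/-- The number of ways in which an edge of a block with `k` vertices appears as a pair `i, i + 1`:
in the cyclic enumeration of a single edge, the edge appears twice. -/
noncomputable def edgeMult (k : ℕ) : ℝ := if k = 2 then 2 else 1

theorem edgeMult_pos (k : ℕ) : 0 < edgeMult k := by
  unfold edgeMult; split_ifs <;> norm_num

theorem two_eq_zero_iff {k : ℕ} (hk : 2 ≤ k) : (2 : ZMod k) = 0 ↔ k = 2 := by
  have : (2 : ZMod k) = ((2 : ℕ) : ZMod k) := by norm_num
  rw [this, ZMod.natCast_eq_zero_iff]
  exact ⟨fun h => le_antisymm (Nat.le_of_dvd (by norm_num) h) hk, fun h => h ▸ dvd_rfl⟩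

theorem CyclicEnum.edgeMult_mul_adj {B : G.Subgraph} (E : CyclicEnum B) [NeZero E.k] (a b : V) :
    (edgeMult E.k * if B.Adj a b then 1 else 0 : ℝ)
      = ∑ i, ((if a = E.x i ∧ b = E.x (i + 1) then 1 else 0)
        + if b = E.x i ∧ a = E.x (i + 1) then 1 else 0) := by
  have key : ∀ j, (edgeMult E.k : ℝ) = ∑ i, ((if E.x j = E.x i ∧ E.x (j + 1) = E.x (i + 1)
      then 1 else 0) + if E.x (j + 1) = E.x i ∧ E.x j = E.x (i + 1) then 1 else 0) := by
    intro j
    have h1 : ∀ i, (E.x j = E.x i ∧ E.x (j + 1) = E.x (i + 1)) ↔ j = i := fun i =>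
      ⟨fun h => E.inj h.1, fun h => by simp [h]⟩
    have h2 : ∀ i, (E.x (j + 1) = E.x i ∧ E.x j = E.x (i + 1)) ↔ (j + 1 = i ∧ E.k = 2) := by
      intro i
      rw [E.inj.eq_iff, E.inj.eq_iff, ← two_eq_zero_iff E.two_le]
      refine and_congr_right fun h => ?_
      rw [← h, add_assoc, left_eq_add]
      norm_num
    simp_rw [h1, h2, Finset.sum_add_distrib, edgeMult]
    by_cases hk : E.k = 2 <;> (simp [hk]; try norm_num)
  by_cases h : B.Adj a b
  · rw [if_pos h, mul_one]
    obtain ⟨j, ⟨rfl, rfl⟩ | ⟨rfl, rfl⟩⟩ := (E.adj_iff _ _).1 h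
    · exact key j
    · rw [key j]
      exact Finset.sum_congr rfl fun i _ => add_comm _ _
  · rw [if_neg h, mul_zero, eq_comm]
    refine Finset.sum_eq_zero fun i _ => ?_
    have h' : ¬ (_ ∨ _) := fun hh => h ((E.adj_iff a b).2 ⟨i, hh⟩)
    rw [not_or] at h'
    rw [if_neg h'.1, if_neg h'.2, add_zero]

variable [Fintype V]

theorem CyclicEnum.edgeMult_mul_sum {B : G.Subgraph} (E : CyclicEnum B) [NeZero E.k]
    (F : V → V → ℝ) : (edgeMult E.k * ∑ a, ∑ b, if B.Adj a b then F a b else 0)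
      = ∑ i, (F (E.x i) (E.x (i + 1)) + F (E.x (i + 1)) (E.x i)) := by
  have h : ∀ a b, edgeMult E.k * (if B.Adj a b then F a b else 0)
      = ∑ i, ((if a = E.x i ∧ b = E.x (i + 1) then F a b else 0)
        + if b = E.x i ∧ a = E.x (i + 1) then F a b else 0) := by
    intro a b
    have := congrArg (· * F a b) (E.edgeMult_mul_adj a b)
    simpa [mul_assoc, Finset.sum_mul, add_mul] using this
  simp_rw [Finset.mul_sum, h]
  have h1 : ∀ a, ∑ b, ∑ i, ((if a = E.x i ∧ b = E.x (i + 1) then F a b else 0)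
        + if b = E.x i ∧ a = E.x (i + 1) then F a b else 0)
      = ∑ i, ∑ b, ((if a = E.x i ∧ b = E.x (i + 1) then F a b else 0)
        + if b = E.x i ∧ a = E.x (i + 1) then F a b else 0) := fun a => Finset.sum_comm
  simp_rw [h1]
  rw [Finset.sum_comm]
  refine Finset.sum_congr rfl fun i _ => ?_
  simp_rw [Finset.sum_add_distrib, ite_and]
  congr 1
  · rw [Finset.sum_eq_single (E.x i)] <;> simp +contextual
  · simp

theorem sum_mul_lapMatrix_mulVec (φ f : V → ℝ) :
    ∑ w, φ w * (G.lapMatrix ℝ).mulVec f w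
      = (∑ w, ∑ z, if G.Adj w z then (φ w - φ z) * (f w - f z) else 0) / 2 := by
  have h1 : ∀ w, (G.lapMatrix ℝ).mulVec f w = ∑ z, if G.Adj w z then f w - f z else 0 := by
    intro w
    rw [lapMatrix_mulVec_apply, degree_eq_sum_if_adj, Finset.sum_mul,
      neighborFinset_eq_filter, Finset.sum_filter, ← Finset.sum_sub_distrib]
    refine Finset.sum_congr rfl fun z _ => ?_
    split_ifs <;> simp
  have h2 : ∑ w, φ w * (G.lapMatrix ℝ).mulVec f w
      = ∑ w, ∑ z, if G.Adj w z then φ w * (f w - f z) else 0 := by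
    refine Finset.sum_congr rfl fun w _ => ?_
    rw [h1, Finset.mul_sum]
    refine Finset.sum_congr rfl fun z _ => ?_
    split_ifs <;> simp
  have h3 : ∑ w, φ w * (G.lapMatrix ℝ).mulVec f w
      = ∑ w, ∑ z, if G.Adj w z then φ z * (f z - f w) else 0 := by
    rw [h2, Finset.sum_comm]
    simp_rw [G.adj_comm]
  have h4 : (∑ w, ∑ z, if G.Adj w z then (φ w - φ z) * (f w - f z) else 0)
      = (∑ w, ∑ z, if G.Adj w z then φ w * (f w - f z) else 0)
        + ∑ w, ∑ z, if G.Adj w z then φ z * (f z - f w) else 0 := by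
    simp_rw [← Finset.sum_add_distrib]
    refine Finset.sum_congr rfl fun w _ => Finset.sum_congr rfl fun z _ => ?_
    split_ifs <;> ring
  rw [h4, ← h2, ← h3]
  ring

/-- Kirchhoff's law in weak form, tested against an arbitrary function `φ`. -/
theorem IsUnitPotential.weak {u v : V} {f : V → ℝ} (hf : IsUnitPotential G u v f) (φ : V → ℝ) :
    (∑ w, ∑ z, if G.Adj w z then (φ w - φ z) * (f w - f z) else 0) / 2 = φ u - φ v := by
  unfold IsUnitPotential at hf
  rw [← sum_mul_lapMatrix_mulVec]
  have : ∀ w, (G.lapMatrix ℝ).mulVec f w = (Pi.single u 1 - Pi.single v 1 : V → ℝ) w := by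
    intro w; rw [← hf]
  simp_rw [this, Pi.sub_apply, mul_sub, Finset.sum_sub_distrib, Pi.single_apply, mul_ite, mul_one,
    mul_zero]
  simp

/-- The energy of a unit potential on the edges of a block is the resistance within the block
between the projections of the two poles. -/
theorem BlockChart.energy_eq {B : G.Subgraph} (χ : BlockChart B) {u v : V} {f : V → ℝ}
    (hf : IsUnitPotential G u v f) :
    (∑ a, ∑ b, if B.Adj a b then (f a - f b) * (f a - f b) else 0) / 2
      = edgeMult χ.k * cycleRes χ.k (χ.proj u - χ.proj v) := by
  have := χ.neZero
  have hm := edgeMult_pos χ.k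
  have hweak : ∀ ψ : ZMod χ.k → ℝ, ∑ i, (ψ i - ψ (i + 1)) * (f (χ.x i) - f (χ.x (i + 1)))
      = edgeMult χ.k * (ψ (χ.proj u) - ψ (χ.proj v)) := by
    intro ψ
    have h1 := hf.weak (fun w => ψ (χ.proj w))
    have h2 : ∀ w z, (if G.Adj w z then (ψ (χ.proj w) - ψ (χ.proj z)) * (f w - f z) else 0)
        = if B.Adj w z then (ψ (χ.proj w) - ψ (χ.proj z)) * (f w - f z) else 0 := by
      intro w z
      by_cases hB : B.Adj w z
      · rw [if_pos hB, if_pos hB.adj_sub]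
      · rw [if_neg hB]
        split_ifs with hG
        · have : χ.proj w = χ.proj z := by
            by_contra hne
            exact hB (χ.cross hG hne)
          rw [this]; ring
        · rfl
    simp_rw [h2] at h1
    have h3 := χ.edgeMult_mul_sum (fun w z => (ψ (χ.proj w) - ψ (χ.proj z)) * (f w - f z))
    simp only [χ.proj_x] at h3
    rw [← h1, mul_div_assoc', h3, Finset.sum_div]
    exact Finset.sum_congr rfl fun i _ => by ring
  have h4 := energy_eq_cycleRes hweak
  have h5 := χ.edgeMult_mul_sum (fun a b => (f a - f b) * (f a - f b))
  have h6 : ∑ i, ((f (χ.x i) - f (χ.x (i + 1))) * (f (χ.x i) - f (χ.x (i + 1)))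
      + (f (χ.x (i + 1)) - f (χ.x i)) * (f (χ.x (i + 1)) - f (χ.x i)))
      = 2 * (edgeMult χ.k ^ 2 * cycleRes χ.k (χ.proj u - χ.proj v)) := by
    rw [← h4, Finset.mul_sum]
    exact Finset.sum_congr rfl fun i _ => by ring
  rw [h6] at h5
  have h7 : edgeMult χ.k ≠ 0 := hm.ne'
  rw [div_eq_iff two_ne_zero]
  apply mul_left_cancel₀ h7
  rw [h5]
  ring

noncomputable instance : Fintype {B : G.Subgraph // IsBlock B} := Fintype.ofFinite _

/-- Every edge lies in exactly one block. -/
theorem sum_isBlock_ite_adj (a b : V) (r : ℝ) :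
    ∑ B : {B : G.Subgraph // IsBlock B}, (if B.1.Adj a b then r else 0)
      = if G.Adj a b then r else 0 := by
  split_ifs with h
  · obtain ⟨B, hB, hab⟩ := exists_isBlock_adj h
    rw [Finset.sum_eq_single ⟨B, hB⟩]
    · rw [if_pos hab]
    · intro B' _ hne
      rw [if_neg]
      intro hab'
      exact hne (Subtype.ext (B'.2.eq_of_adj hB hab' hab))
    · simp
  · refine Finset.sum_eq_zero fun B _ => ?_
    rw [if_neg fun hab => h hab.adj_sub]

theorem resistance_eq_sum (hG : G.Connected)
    (χ : ∀ B : {B : G.Subgraph // IsBlock B}, BlockChart B.1) (u v : V) :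
    resistance G u v
      = ∑ B, edgeMult (χ B).k * cycleRes (χ B).k ((χ B).proj u - (χ B).proj v) := by
  obtain ⟨f, hf⟩ := exists_isUnitPotential hG u v
  rw [hf.resistance_eq hG, ← hf.weak f]
  simp_rw [← fun B => (χ B).energy_eq hf, ← sum_isBlock_ite_adj]
  rw [← Finset.sum_div]
  congr 1
  rw [Finset.sum_comm]
  rw [Finset.sum_comm]
  have h1 : ∀ w : V, ∑ z, ∑ B : {B : G.Subgraph // IsBlock B},
      (if B.1.Adj w z then (f w - f z) * (f w - f z) else 0)
      = ∑ B : {B : G.Subgraph // IsBlock B}, ∑ z,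
      (if B.1.Adj w z then (f w - f z) * (f w - f z) else 0) := fun w => Finset.sum_comm
  simp_rw [h1]
  exact Finset.sum_comm

/-- The share of a block in the degree resistance distance. -/
noncomputable def BlockChart.share {B : G.Subgraph} (χ : BlockChart B) : ℝ :=
  ∑ u, ∑ v, (G.degree u : ℝ) * (edgeMult χ.k * cycleRes χ.k (χ.proj u - χ.proj v))

theorem degreeResistanceDistance_eq_sum_share (hG : G.Connected)
    (χ : ∀ B : {B : G.Subgraph // IsBlock B}, BlockChart B.1) :
    degreeResistanceDistance G = ∑ B, (χ B).share := by
  have hsymm : ∀ u v, resistance G u v = resistance G v u := by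
    intro u v
    rw [resistance_eq_sum hG χ, resistance_eq_sum hG χ]
    refine Finset.sum_congr rfl fun B _ => ?_
    have := (χ B).neZero
    rw [← cycleRes_neg, neg_sub]
  have h1 : degreeResistanceDistance G = ∑ u, ∑ v, (G.degree u : ℝ) * resistance G u v := by
    have h2 : ∑ u, ∑ v, (G.degree v : ℝ) * resistance G u v
        = ∑ u, ∑ v, (G.degree u : ℝ) * resistance G u v := by
      rw [Finset.sum_comm]
      simp_rw [fun u v => hsymm v u]
    unfold degreeResistanceDistance
    simp_rw [add_mul, Finset.sum_add_distrib]
    rw [h2]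
    ring
  rw [h1]
  simp_rw [resistance_eq_sum hG χ, Finset.mul_sum]
  unfold BlockChart.share
  have h3 : ∀ u : V, ∑ v, ∑ B, (G.degree u : ℝ)
        * (edgeMult (χ B).k * cycleRes (χ B).k ((χ B).proj u - (χ B).proj v))
      = ∑ B, ∑ v, (G.degree u : ℝ)
        * (edgeMult (χ B).k * cycleRes (χ B).k ((χ B).proj u - (χ B).proj v)) :=
    fun u => Finset.sum_comm
  simp_rw [h3]
  exact Finset.sum_comm

end Energy

/-! ### The share of a block -/

section Share

open Classical

variable {V : Type*} {G : SimpleGraph V} {B : G.Subgraph}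

/-- The degree, within its block, of a vertex of a block with `k` vertices. -/
noncomputable def blockDeg (k : ℕ) : ℝ := 2 / edgeMult k

namespace BlockChart

/-- All vertices of the block but the vertex number `i₀` are projections of themselves only: the
rest of the graph is attached to the vertex number `i₀`. -/
def PendentAt (χ : BlockChart B) (i₀ : ZMod χ.k) : Prop :=
  ∀ v, χ.proj v ≠ i₀ → v = χ.x (χ.proj v)

/-- The rest of the graph is attached to a single vertex of the block. -/
def Pendent (χ : BlockChart B) : Prop := ∃ i₀, χ.PendentAt i₀

theorem proj_eq_of_adj (χ : BlockChart B) {u v : V} (h : (G \ B.spanningCoe).Adj u v) :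
    χ.proj u = χ.proj v := by
  by_contra hne
  exact h.2 (χ.cross h.1 hne)

theorem two_thirds_le (χ : BlockChart B) [NeZero χ.k] {z : ZMod χ.k} (hz : z ≠ 0) :
    2 / 3 ≤ edgeMult χ.k * cycleRes χ.k z := by
  have h := le_cycleRes hz
  have hk := χ.two_le
  unfold edgeMult
  split_ifs with h2
  · have : (χ.k : ℝ) = 2 := by rw [h2]; norm_num
    rw [this] at h
    linarith
  · have h3 : (3 : ℝ) ≤ χ.k := by exact_mod_cast (by omega : 3 ≤ χ.k)
    have : 2 / 3 ≤ ((χ.k : ℝ) - 1) / χ.k := by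
      rw [div_le_div_iff₀ (by norm_num) (by linarith)]
      linarith
    linarith

theorem connected_fiber (χ : BlockChart B) (i : ZMod χ.k) :
    ((G \ B.spanningCoe).induce {v | χ.proj v = i}).Connected := by
  have key : ∀ {a b : V} (_ : (G \ B.spanningCoe).Walk a b) (ha : χ.proj a = i)
      (hb : χ.proj b = i), ((G \ B.spanningCoe).induce {v | χ.proj v = i}).Reachable
        ⟨a, ha⟩ ⟨b, hb⟩ := by
    intro a b p
    induction p with
    | nil => exact fun _ _ => Reachable.refl _
    | @cons a c b h q ih =>
      intro ha hb
      have hc : χ.proj c = i := (χ.proj_eq_of_adj h).symm.trans ha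
      have hadj : ((G \ B.spanningCoe).induce {v | χ.proj v = i}).Adj ⟨a, ha⟩ ⟨c, hc⟩ := h
      exact hadj.reachable.trans (ih hc hb)
  have : Nonempty {v | χ.proj v = i} := ⟨⟨χ.x i, χ.proj_x i⟩⟩
  refine ⟨fun a b => ?_⟩
  have h1 : ∀ a : {v | χ.proj v = i}, ((G \ B.spanningCoe).induce {v | χ.proj v = i}).Reachable
      a ⟨χ.x i, χ.proj_x i⟩ := by
    rintro ⟨a, ha⟩
    have h := χ.reach a
    have ha' : χ.proj a = i := ha
    rw [ha'] at h
    obtain ⟨p⟩ := h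
    exact key p ha (χ.proj_x i)
  exact (h1 a).trans (h1 b).symm

end BlockChart

variable [Fintype V]

theorem CyclicEnum.sum_adj (E : CyclicEnum B) (i : ZMod E.k) :
    (∑ z, if B.Adj (E.x i) z then 1 else 0 : ℝ) = blockDeg E.k := by
  have := E.neZero
  have hm := edgeMult_pos E.k
  have h := E.edgeMult_mul_sum (fun a _ => if a = E.x i then 1 else 0)
  have h1 : (∑ a, ∑ b, if B.Adj a b then (if a = E.x i then 1 else 0) else 0 : ℝ)
      = ∑ z, if B.Adj (E.x i) z then 1 else 0 := by
    rw [Finset.sum_eq_single (E.x i)]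
    · simp
    · intro a _ ha
      simp [ha]
    · simp
  have h2 : ∑ j, ((if E.x j = E.x i then 1 else 0) + if E.x (j + 1) = E.x i then 1 else 0 : ℝ)
      = 2 := by
    simp_rw [E.inj.eq_iff, Finset.sum_add_distrib, ← eq_sub_iff_add_eq]
    simp
    norm_num
  rw [h1, h2] at h
  rw [blockDeg, eq_div_iff hm.ne', mul_comm, h]

theorem CyclicEnum.sum_sum_adj (E : CyclicEnum B) :
    (∑ a, ∑ b, if B.Adj a b then 1 else 0 : ℝ) = 2 * (E.k / edgeMult E.k) := by
  have := E.neZero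
  have hm := edgeMult_pos E.k
  have h := E.edgeMult_mul_sum (fun _ _ => 1)
  have h2 : ∑ _j : ZMod E.k, (1 + 1 : ℝ) = 2 * E.k := by
    simp [ZMod.card]; ring
  rw [h2] at h
  rw [mul_div_assoc', eq_div_iff hm.ne', mul_comm, h]

namespace BlockChart

/-- The number of vertices projecting to the vertex number `i` of the block. -/
noncomputable def size (χ : BlockChart B) (i : ZMod χ.k) : ℝ :=
  ∑ v, if χ.proj v = i then 1 else 0

/-- The sum of the degrees of the vertices projecting to the vertex number `i` of the block. -/
noncomputable def vol (χ : BlockChart B) (i : ZMod χ.k) : ℝ :=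
  ∑ v, if χ.proj v = i then (G.degree v : ℝ) else 0

theorem sum_mul_comp_proj (χ : BlockChart B) [NeZero χ.k] (w : V → ℝ) (h : ZMod χ.k → ℝ) :
    ∑ v, w v * h (χ.proj v) = ∑ i, (∑ v, if χ.proj v = i then w v else 0) * h i := by
  simp_rw [Finset.sum_mul]
  rw [Finset.sum_comm]
  refine Finset.sum_congr rfl fun v _ => ?_
  simp

theorem sum_size (χ : BlockChart B) [NeZero χ.k] : ∑ i, χ.size i = Fintype.card V := by
  have := χ.sum_mul_comp_proj (fun _ => 1) (fun _ => 1)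
  simp only [mul_one] at this
  unfold size
  rw [← this]
  simp

theorem sum_vol (χ : BlockChart B) [NeZero χ.k] : ∑ i, χ.vol i = ∑ v, (G.degree v : ℝ) := by
  have := χ.sum_mul_comp_proj (fun v => (G.degree v : ℝ)) (fun _ => 1)
  simp only [mul_one] at this
  exact this.symm

theorem share_eq_sum (χ : BlockChart B) [NeZero χ.k] :
    χ.share = ∑ i, ∑ j, χ.vol i * χ.size j * (edgeMult χ.k * cycleRes χ.k (i - j)) := by
  unfold share
  have h1 : ∀ u, ∑ v, (G.degree u : ℝ) * (edgeMult χ.k * cycleRes χ.k (χ.proj u - χ.proj v))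
      = (G.degree u : ℝ) * ∑ j, χ.size j * (edgeMult χ.k * cycleRes χ.k (χ.proj u - j)) := by
    intro u
    rw [← Finset.mul_sum]
    congr 1
    have := χ.sum_mul_comp_proj (fun _ => 1)
      (fun j => edgeMult χ.k * cycleRes χ.k (χ.proj u - j))
    simp only [one_mul] at this
    exact this
  simp_rw [h1]
  rw [χ.sum_mul_comp_proj (fun u => (G.degree u : ℝ))
    (fun i => ∑ j, χ.size j * (edgeMult χ.k * cycleRes χ.k (i - j)))]
  refine Finset.sum_congr rfl fun i _ => ?_
  rw [Finset.mul_sum]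
  exact Finset.sum_congr rfl fun j _ => by unfold vol; ring

/-- The share of a block as the value for a block with everything attached to one vertex, plus a
correction that is nonnegative. -/
theorem share_eq (χ : BlockChart B) [NeZero χ.k] :
    χ.share = edgeMult χ.k * (((χ.k : ℝ) ^ 2 - 1) / 6)
        * (∑ v, (G.degree v : ℝ) + blockDeg χ.k * (Fintype.card V - χ.k))
      + ∑ i, ∑ j, (χ.vol i - blockDeg χ.k) * (χ.size j - 1)
        * (edgeMult χ.k * cycleRes χ.k (i - j)) := by
  have h1 : ∑ i, ∑ j, χ.vol i * (edgeMult χ.k * cycleRes χ.k (i - j))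
      = edgeMult χ.k * (((χ.k : ℝ) ^ 2 - 1) / 6) * ∑ v, (G.degree v : ℝ) := by
    simp_rw [← Finset.mul_sum, sum_cycleRes_sub_left, ← Finset.sum_mul, sum_vol]
    ring
  have h2 : ∑ i, ∑ j, blockDeg χ.k * (χ.size j - 1) * (edgeMult χ.k * cycleRes χ.k (i - j))
      = edgeMult χ.k * (((χ.k : ℝ) ^ 2 - 1) / 6) * (blockDeg χ.k * (Fintype.card V - χ.k)) := by
    rw [Finset.sum_comm]
    simp_rw [← Finset.mul_sum, sum_cycleRes_sub_right, ← Finset.sum_mul, ← Finset.mul_sum,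
      Finset.sum_sub_distrib, sum_size]
    simp [ZMod.card]
    ring
  rw [share_eq_sum, mul_add, ← h1, ← h2]
  simp_rw [← Finset.sum_add_distrib]
  exact Finset.sum_congr rfl fun i _ => Finset.sum_congr rfl fun j _ => by ring

theorem size_eq_card (χ : BlockChart B) (i : ZMod χ.k) :
    χ.size i = Fintype.card {v | χ.proj v = i} := by
  rw [size, Finset.sum_boole, Fintype.card_subtype]
  simp

/-- A connected graph on `N` vertices has at least `N - 1` edges; the block itself contributes
`blockDeg`. -/
theorem le_vol (χ : BlockChart B) (i : ZMod χ.k) :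
    blockDeg χ.k + 2 * (χ.size i - 1) ≤ χ.vol i := by
  set H := (G \ B.spanningCoe).induce {v | χ.proj v = i} with hH
  have h1 := (χ.connected_fiber i).card_vert_le_card_edgeSet_add_one
  have h2 := H.sum_degrees_eq_twice_card_edges
  have h3 : Nat.card H.edgeSet = H.edgeFinset.card := by
    rw [Nat.card_eq_fintype_card, edgeFinset_card]
  have h4 : 2 * (χ.size i - 1) ≤ ∑ a, (H.degree a : ℝ) := by
    rw [size_eq_card, ← Nat.card_eq_fintype_card]
    have h5 : (∑ a, (H.degree a : ℝ)) = ((2 * H.edgeFinset.card : ℕ) : ℝ) := by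
      rw [← h2]; push_cast; rfl
    rw [h5, ← h3]
    have h6 : ((Nat.card {v | χ.proj v = i} : ℕ) : ℝ) ≤ Nat.card H.edgeSet + 1 := by
      exact_mod_cast h1
    push_cast
    linarith
  have h7 : ∑ a, (H.degree a : ℝ) = ∑ v, if χ.proj v = i then
      (∑ z, if χ.proj z = i then (if (G \ B.spanningCoe).Adj v z then 1 else 0) else 0 : ℝ)
      else 0 := by
    have hsub : ∀ g : V → ℝ, ∑ a : {v | χ.proj v = i}, g a = ∑ v, if χ.proj v = i then g v else 0 := by
      intro g
      rw [← Finset.sum_filter]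
      exact (Finset.sum_subtype _ (by simp) g).symm
    simp_rw [degree_eq_sum_if_adj, hH, induce_adj]
    rw [← hsub]
    exact Finset.sum_congr rfl fun a _ =>
      hsub (fun z => if (G \ B.spanningCoe).Adj a z then 1 else 0)
  have h8 : χ.vol i = ∑ v, if χ.proj v = i then (∑ z, if G.Adj v z then 1 else 0 : ℝ) else 0 := by
    unfold vol
    simp_rw [degree_eq_sum_if_adj]
  have h9 : blockDeg χ.k = ∑ v, if χ.proj v = i then
      (∑ z, if v = χ.x i then (if B.Adj v z then 1 else 0) else 0 : ℝ) else 0 := by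
    rw [Finset.sum_eq_single (χ.x i), if_pos (χ.proj_x i), ← χ.sum_adj i]
    · simp
    · intro v _ hv
      simp [hv]
    · simp
  refine (add_le_add_right h4 _).trans ?_
  rw [h7, h8, h9, ← Finset.sum_add_distrib]
  refine Finset.sum_le_sum fun v _ => ?_
  by_cases hv : χ.proj v = i
  · rw [if_pos hv, if_pos hv, if_pos hv, ← Finset.sum_add_distrib]
    refine Finset.sum_le_sum fun z _ => ?_
    by_cases hB : B.Adj v z
    · have h1 : G.Adj v z := hB.adj_sub
      have h2 : ¬ (G \ B.spanningCoe).Adj v z := fun h => h.2 hB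
      simp only [h1, h2, hB, if_true, if_false]
      split_ifs <;> norm_num
    · by_cases hA : G.Adj v z
      · have h2 : (G \ B.spanningCoe).Adj v z := ⟨hA, hB⟩
        simp only [hA, h2, hB, if_true, if_false]
        split_ifs <;> norm_num
      · have h2 : ¬ (G \ B.spanningCoe).Adj v z := fun h => hA h.1
        simp only [hA, h2, hB, if_false]
        split_ifs <;> norm_num
  · rw [if_neg hv, if_neg hv, if_neg hv, add_zero]

theorem one_le_size (χ : BlockChart B) (i : ZMod χ.k) : 1 ≤ χ.size i := by
  rw [size_eq_card]
  have : Nonempty {v | χ.proj v = i} := ⟨⟨χ.x i, χ.proj_x i⟩⟩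
  exact_mod_cast Fintype.card_pos

theorem size_eq_one_or_two_le (χ : BlockChart B) (i : ZMod χ.k) :
    (∀ v, χ.proj v = i → v = χ.x i) ∨ 2 ≤ χ.size i := by
  rw [or_iff_not_imp_left]
  intro h
  push Not at h
  obtain ⟨v, hv, hne⟩ := h
  rw [size_eq_card]
  have : 1 < Fintype.card {v | χ.proj v = i} := Fintype.one_lt_card_iff.2
    ⟨⟨v, hv⟩, ⟨χ.x i, χ.proj_x i⟩, fun h => hne (congrArg Subtype.val h)⟩
  exact_mod_cast this

theorem size_eq_one (χ : BlockChart B) {i : ZMod χ.k} (h : ∀ v, χ.proj v = i → v = χ.x i) :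
    χ.size i = 1 := by
  unfold size
  rw [Finset.sum_eq_single (χ.x i), if_pos (χ.proj_x i)]
  · intro v _ hv
    rw [if_neg fun hi => hv (h v hi)]
  · simp

theorem vol_eq_blockDeg (χ : BlockChart B) {i : ZMod χ.k} (h : ∀ v, χ.proj v = i → v = χ.x i) :
    χ.vol i = blockDeg χ.k := by
  unfold vol
  rw [Finset.sum_eq_single (χ.x i), if_pos (χ.proj_x i), ← χ.sum_adj i, degree_eq_sum_if_adj]
  · refine Finset.sum_congr rfl fun z _ => ?_
    have : G.Adj (χ.x i) z ↔ B.Adj (χ.x i) z := by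
      refine ⟨fun hA => χ.cross hA fun hp => hA.ne ?_, fun hB => hB.adj_sub⟩
      rw [χ.proj_x] at hp
      exact (h z hp.symm).symm
    simp only [this]
  · intro v _ hv
    rw [if_neg fun hi => hv (h v hi)]
  · simp

/-- The difference between the share of a block and that of a pendent block of the same length, see
`share_eq`. -/
noncomputable def corr (χ : BlockChart B) [NeZero χ.k] : ℝ :=
  ∑ i, ∑ j, (χ.vol i - blockDeg χ.k) * (χ.size j - 1) * (edgeMult χ.k * cycleRes χ.k (i - j))

theorem corr_eq_zero (χ : BlockChart B) [NeZero χ.k] (h : χ.Pendent) : χ.corr = 0 := by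
  obtain ⟨i₀, h⟩ := h
  refine Finset.sum_eq_zero fun i _ => Finset.sum_eq_zero fun j _ => ?_
  have hi : ∀ i, i ≠ i₀ → ∀ v, χ.proj v = i → v = χ.x i := by
    rintro _ hne v rfl
    exact h v hne
  by_cases hj : j = i₀
  · by_cases hi' : i = i₀
    · simp [hj, hi']
    · rw [χ.vol_eq_blockDeg (hi i hi')]; ring
  · rw [χ.size_eq_one (hi j hj)]; ring

theorem le_corr (χ : BlockChart B) [NeZero χ.k] :
    4 / 3 * ∑ i, ∑ j, (if i = j then 0 else (χ.size i - 1) * (χ.size j - 1)) ≤ χ.corr := by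
  unfold corr
  simp_rw [Finset.mul_sum]
  refine Finset.sum_le_sum fun i _ => Finset.sum_le_sum fun j _ => ?_
  have h1 := χ.le_vol i
  have h2 := χ.one_le_size i
  have h3 := χ.one_le_size j
  split_ifs with hij
  · simp [hij]
  · have h4 := χ.two_thirds_le (sub_ne_zero.2 hij)
    have h5 : 2 * (χ.size i - 1) * (χ.size j - 1) ≤ (χ.vol i - blockDeg χ.k) * (χ.size j - 1) :=
      mul_le_mul_of_nonneg_right (by linarith) (by linarith)
    have h6 : 0 ≤ 2 * (χ.size i - 1) * (χ.size j - 1) :=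
      mul_nonneg (by linarith) (by linarith)
    calc _ = 2 * (χ.size i - 1) * (χ.size j - 1) * (2 / 3) := by ring
      _ ≤ _ := mul_le_mul h5 h4 (by norm_num) (h6.trans h5)

theorem corr_nonneg (χ : BlockChart B) [NeZero χ.k] : 0 ≤ χ.corr := by
  refine le_trans ?_ χ.le_corr
  refine mul_nonneg (by norm_num) (Finset.sum_nonneg fun i _ => Finset.sum_nonneg fun j _ => ?_)
  have h2 := χ.one_le_size i
  have h3 := χ.one_le_size j
  split_ifs
  · exact le_rfl
  · exact mul_nonneg (by linarith) (by linarith)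

/-- If something is attached to two vertices of the block, with `p` and `q` further vertices behind
them, then `p * q ≥ p + q - 1` bounds the correction from below. -/
theorem le_corr_of_not_pendent (χ : BlockChart B) [NeZero χ.k] (h : ¬ χ.Pendent) :
    8 / 3 * ((Fintype.card V : ℝ) - χ.k - 1) ≤ χ.corr := by
  obtain ⟨p, hp⟩ : ∃ p, 2 ≤ χ.size p := by
    by_contra hcon
    push Not at hcon
    refine h ⟨0, fun v _ => ?_⟩
    rcases χ.size_eq_one_or_two_le (χ.proj v) with h1 | h1
    · exact h1 v rfl
    · exact absurd h1 (not_le.2 (hcon _))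
  obtain ⟨q, hqp, hq⟩ : ∃ q, q ≠ p ∧ 2 ≤ χ.size q := by
    by_contra hcon
    push Not at hcon
    refine h ⟨p, fun v hv => ?_⟩
    rcases χ.size_eq_one_or_two_le (χ.proj v) with h1 | h1
    · exact h1 v rfl
    · exact absurd h1 (not_le.2 (hcon _ hv))
  refine le_trans ?_ χ.le_corr
  have ha : ∀ i, 0 ≤ χ.size i - 1 := fun i => by have := χ.one_le_size i; linarith
  have hA : ∑ i, (χ.size i - 1) = Fintype.card V - χ.k := by
    simp [Finset.sum_sub_distrib, sum_size, ZMod.card]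
  generalize (Fintype.card V : ℝ) - χ.k = A at hA ⊢
  have hp' : 1 ≤ χ.size p - 1 := by linarith
  have hq' : 1 ≤ χ.size q - 1 := by linarith
  generalize ha' : (fun i => χ.size i - 1) = a
  have hai : ∀ i, χ.size i - 1 = a i := fun i => by rw [← ha']
  simp only [hai] at *
  have hsplit : a p + ∑ i ∈ Finset.univ.erase p, a i = A := by
    rw [← hA]; exact Finset.add_sum_erase _ a (Finset.mem_univ p)
  have hqle : a q ≤ ∑ i ∈ Finset.univ.erase p, a i :=
    Finset.single_le_sum (fun i _ => ha i) (Finset.mem_erase.2 ⟨hqp, Finset.mem_univ q⟩)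
  -- Keep only the terms in which one of the two indices is `p`.
  have hrow : ∀ i, (∑ j, if i = j then 0 else a i * a j) ≥
      if i = p then a p * (A - a p) else a i * a p := by
    intro i
    split_ifs with hi
    · subst hi
      rw [← hsplit, add_sub_cancel_left, Finset.mul_sum, ← Finset.add_sum_erase _ _
        (Finset.mem_univ i), if_pos rfl, zero_add]
      refine Finset.sum_le_sum fun j hj => ?_
      rw [if_neg (Finset.ne_of_mem_erase hj).symm]
    · have := Finset.single_le_sum (f := fun j => if i = j then 0 else a i * a j)
        (fun j _ => by
          split_ifs
          · exact le_rfl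
          · exact mul_nonneg (ha i) (ha j)) (Finset.mem_univ p)
      simpa [hi] using this
  have hsum : ∑ i, (if i = p then a p * (A - a p) else a i * a p) = 2 * (a p * (A - a p)) := by
    rw [← Finset.add_sum_erase _ _ (Finset.mem_univ p), if_pos rfl]
    have : ∑ i ∈ Finset.univ.erase p, (if i = p then a p * (A - a p) else a i * a p)
        = ∑ i ∈ Finset.univ.erase p, a i * a p :=
      Finset.sum_congr rfl fun i hi => if_neg (Finset.ne_of_mem_erase hi)
    rw [this, ← Finset.sum_mul, ← hsplit]
    ring
  have h1 := Finset.sum_le_sum fun i (_ : i ∈ Finset.univ) => hrow i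
  rw [hsum] at h1
  have h2 : (1 : ℝ) ≤ A - a p := by linarith
  nlinarith

end BlockChart
end Share

/-! ### Lower bounds for the shares of the blocks -/

section Excess

open Classical

/-- The least possible share of a bridge in a cactus with `n` vertices and `t` cycles. -/
noncomputable def bridgeMin (n t : ℝ) : ℝ := 3 * n - 4 + 2 * t

/-- The least possible share of a triangle in a cactus with `n` vertices and `t` cycles. -/
noncomputable def triangleMin (n t : ℝ) : ℝ := 4 / 3 * (4 * n + 2 * t - 8)

/-- The reference share of a block with `k` vertices: a cycle of length `k` is compared with a
triangle and `k - 3` bridges, as these use up equally many edges and cycles. -/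
noncomputable def minShare (k : ℕ) (n t : ℝ) : ℝ :=
  k / edgeMult k * bridgeMin n t + if 3 ≤ k then triangleMin n t - 3 * bridgeMin n t else 0

/-- The sum of the reference shares over the blocks of a cactus, which only depends on `n` and
`t`. -/
noncomputable def minValue (n t : ℝ) : ℝ :=
  (n - 1 + t) * bridgeMin n t + t * (triangleMin n t - 3 * bridgeMin n t)

/-- The amount by which the share of a pendent 4-cycle exceeds its reference share. -/
noncomputable def gap (n t : ℝ) : ℝ := (5 * n + t - 31) / 3

theorem gap_pos {n t : ℝ} (hn : 7 ≤ n) (ht : 1 ≤ t) : 0 < gap n t := by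
  unfold gap; linarith

variable {V : Type*} [Fintype V] {G : SimpleGraph V} {B : G.Subgraph}

/-- The difference between the share of a block and its reference share. -/
noncomputable def BlockChart.excess (χ : BlockChart B) (t : ℝ) : ℝ :=
  χ.share - minShare χ.k (Fintype.card V) t

theorem CyclicEnum.k_le_card (E : CyclicEnum B) : E.k ≤ Fintype.card V := by
  have := E.neZero
  rw [← ZMod.card E.k]
  exact Fintype.card_le_of_injective _ E.inj

namespace BlockChart

theorem excess_eq_of_two (χ : BlockChart B) [NeZero χ.k] {t : ℝ}
    (hdeg : ∑ v, (G.degree v : ℝ) = 2 * (Fintype.card V - 1 + t)) (hk : χ.k = 2) :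
    χ.excess t = χ.corr := by
  have hk' : (χ.k : ℝ) = 2 := by rw [hk]; norm_num
  rw [excess, share_eq, hdeg, minShare, if_neg (by omega), hk', ← corr, bridgeMin, blockDeg,
    edgeMult, if_pos hk]
  ring

/-- The polynomial identity behind the comparison of cycle lengths: it shows at once that the
triangle is optimal, the 4-cycle comes next, and all longer cycles are worse. -/
theorem excess_eq_of_three_le (χ : BlockChart B) [NeZero χ.k] {t : ℝ}
    (hdeg : ∑ v, (G.degree v : ℝ) = 2 * (Fintype.card V - 1 + t)) (hk : 3 ≤ χ.k) :
    χ.excess t = gap (Fintype.card V) t + (χ.k - 4) / 3 * ((2 * χ.k - 1) * (Fintype.card V - χ.k)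
      + (χ.k - 7) * (χ.k + 1) + (χ.k - 2) * t) + χ.corr := by
  rw [excess, share_eq, hdeg, minShare, if_pos hk, ← corr, bridgeMin, triangleMin, blockDeg,
    edgeMult, if_neg (by omega), gap]
  ring

theorem excess_eq_zero (χ : BlockChart B) {t : ℝ}
    (hdeg : ∑ v, (G.degree v : ℝ) = 2 * (Fintype.card V - 1 + t)) (hk : χ.k ≤ 3)
    (hp : χ.Pendent) : χ.excess t = 0 := by
  have := χ.neZero
  have h2 := χ.two_le
  rcases h2.eq_or_lt with h | h
  · rw [χ.excess_eq_of_two hdeg h.symm, χ.corr_eq_zero hp]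
  · have h3 : χ.k = 3 := by omega
    have h3' : (χ.k : ℝ) = 3 := by rw [h3]; norm_num
    rw [χ.excess_eq_of_three_le hdeg h, χ.corr_eq_zero hp, gap, h3']
    ring

theorem excess_eq_gap (χ : BlockChart B) {t : ℝ}
    (hdeg : ∑ v, (G.degree v : ℝ) = 2 * (Fintype.card V - 1 + t)) (hk : χ.k = 4)
    (hp : χ.Pendent) : χ.excess t = gap (Fintype.card V) t := by
  have := χ.neZero
  have h4' : (χ.k : ℝ) = 4 := by rw [hk]; norm_num
  rw [χ.excess_eq_of_three_le hdeg (by omega), χ.corr_eq_zero hp, h4']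
  ring

theorem gap_lt_excess (χ : BlockChart B) {t : ℝ}
    (hdeg : ∑ v, (G.degree v : ℝ) = 2 * (Fintype.card V - 1 + t)) (hn : 7 ≤ Fintype.card V)
    (ht : 1 ≤ t) (htn : t ≤ Fintype.card V) (h : ¬ (χ.k ≤ 4 ∧ χ.Pendent)) :
    gap (Fintype.card V) t < χ.excess t := by
  have := χ.neZero
  have h2 := χ.two_le
  have hn' : (7 : ℝ) ≤ Fintype.card V := by exact_mod_cast hn
  rcases Nat.lt_or_ge 4 χ.k with h4 | h4
  · rw [χ.excess_eq_of_three_le hdeg (by omega)]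
    have hc := χ.corr_nonneg
    have hkn : (χ.k : ℝ) ≤ Fintype.card V := by exact_mod_cast χ.k_le_card
    have h5 : (5 : ℝ) ≤ χ.k := by exact_mod_cast h4
    generalize (Fintype.card V : ℝ) = n at *
    have hpos : 0 < (2 * (χ.k : ℝ) - 1) * (n - χ.k) + (χ.k - 7) * (χ.k + 1) + (χ.k - 2) * t := by
      have h6 : 0 ≤ (2 * (χ.k : ℝ) - 1) * (n - χ.k) := mul_nonneg (by linarith) (by linarith)
      have h7 : (χ.k - 2 : ℝ) ≤ (χ.k - 2) * t := le_mul_of_one_le_right (by linarith) ht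
      rcases Nat.lt_or_ge χ.k 7 with h8 | h8
      · obtain h9 | h9 : χ.k = 5 ∨ χ.k = 6 := by omega
        · have : (χ.k : ℝ) = 5 := by rw [h9]; norm_num
          rw [this] at hkn h6 h7 ⊢
          linarith
        · have : (χ.k : ℝ) = 6 := by rw [h9]; norm_num
          rw [this] at hkn h6 h7 ⊢
          linarith
      · have h8' : (7 : ℝ) ≤ χ.k := by exact_mod_cast h8
        have h10 : 0 ≤ (χ.k - 7 : ℝ) * (χ.k + 1) := mul_nonneg (by linarith) (by linarith)
        linarith
    have := mul_pos (show (0 : ℝ) < (χ.k - 4) / 3 by linarith) hpos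
    linarith
  · have hp : ¬ χ.Pendent := fun hp => h ⟨h4, hp⟩
    have hc := χ.le_corr_of_not_pendent hp
    obtain hk | hk | hk : χ.k = 2 ∨ χ.k = 3 ∨ χ.k = 4 := by omega
    · rw [χ.excess_eq_of_two hdeg hk, gap]
      have : (χ.k : ℝ) = 2 := by rw [hk]; norm_num
      rw [this] at hc
      linarith
    · rw [χ.excess_eq_of_three_le hdeg (by omega), gap]
      have : (χ.k : ℝ) = 3 := by rw [hk]; norm_num
      rw [this] at hc ⊢
      linarith
    · rw [χ.excess_eq_of_three_le hdeg (by omega), gap]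
      have : (χ.k : ℝ) = 4 := by rw [hk]; norm_num
      rw [this] at hc ⊢
      linarith

end BlockChart

theorem IsCactus.sum_degrees (hG : IsCactus G) :
    ∑ v, (G.degree v : ℝ) = 2 * (Fintype.card V - 1 + numCycles G) := by
  have h1 := hG.ncard_edgeSet
  have h2 := G.sum_degrees_eq_twice_card_edges
  rw [← coe_edgeFinset, Set.ncard_coe_finset] at h1
  have h3 : (∑ v, (G.degree v : ℝ)) = ((2 * G.edgeFinset.card : ℕ) : ℝ) := by
    rw [← h2]; push_cast; rfl
  have h4 : (G.edgeFinset.card : ℝ) + 1 = Fintype.card V + numCycles G := by exact_mod_cast h1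
  rw [h3]
  push_cast
  linarith

theorem IsCactus.card_isCycle (hG : IsCactus G) :
    (Finset.univ.filter fun B : {B : G.Subgraph // IsBlock B} => IsCycleSubgraph B.1).card
      = numCycles G := by
  have hinj : Set.InjOn (Subtype.val : {B : G.Subgraph // IsBlock B} → G.Subgraph)
      {B | IsCycleSubgraph B.1} := Subtype.val_injective.injOn
  have h : {C : G.Subgraph | IsCycleSubgraph C}
      = Subtype.val '' {B : {B : G.Subgraph // IsBlock B} | IsCycleSubgraph B.1} := by
    ext C
    constructor
    · exact fun hC => ⟨⟨C, hG.isBlock_of_isCycleSubgraph hC⟩, hC, rfl⟩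
    · rintro ⟨B, hB, rfl⟩
      exact hB
  rw [numCycles, h, hinj.ncard_image, ← Set.ncard_coe_finset]
  simp

/-- The degree resistance distance is a constant plus the sum of the excesses of the blocks. -/
theorem IsCactus.degreeResistanceDistance_eq (hG : IsCactus G)
    (χ : ∀ B : {B : G.Subgraph // IsBlock B}, BlockChart B.1) :
    degreeResistanceDistance G
      = minValue (Fintype.card V) (numCycles G) + ∑ B, (χ B).excess (numCycles G) := by
  rw [degreeResistanceDistance_eq_sum_share hG.1 χ]
  have h1 : ∑ B, minShare (χ B).k (Fintype.card V) (numCycles G)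
      = minValue (Fintype.card V) (numCycles G) := by
    unfold minShare minValue
    rw [Finset.sum_add_distrib, ← Finset.sum_mul]
    congr 2
    · have h2 : ∀ B, ((χ B).k : ℝ) / edgeMult (χ B).k
          = (∑ a, ∑ b, if B.1.Adj a b then 1 else 0 : ℝ) / 2 := fun B => by
        rw [(χ B).sum_sum_adj]; ring
      simp_rw [h2]
      rw [← Finset.sum_div, Finset.sum_comm]
      have h3 : ∀ a, ∑ B : {B : G.Subgraph // IsBlock B},
          (∑ b, if B.1.Adj a b then 1 else 0 : ℝ) = G.degree a := by
        intro a
        rw [Finset.sum_comm, degree_eq_sum_if_adj]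
        exact Finset.sum_congr rfl fun b _ => sum_isBlock_ite_adj a b 1
      simp_rw [h3]
      rw [hG.sum_degrees]
      ring
    · have h4 : ∀ B, (3 ≤ (χ B).k) ↔ IsCycleSubgraph B.1 := fun B => (χ B).isCycle_iff.symm
      simp_rw [h4]
      rw [← Finset.sum_filter, Finset.sum_const, hG.card_isCycle, nsmul_eq_mul]
  rw [← h1, ← Finset.sum_add_distrib]
  exact Finset.sum_congr rfl fun B _ => by unfold BlockChart.excess; ring

end Excess

/-! ### Pendent blocks and the shape of the graph -/

section Shape

variable {V : Type*}

/-- A description of the graphs isomorphic to `minGraph`: one vertex is adjacent to all the others,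
and these have degree at most 2. -/
def HasMinShape (G : SimpleGraph V) : Prop :=
  ∃ c, ∀ v, v ≠ c → G.Adj c v ∧ (G.neighborSet v).ncard ≤ 2

/-- A description of the graphs isomorphic to `secondMinGraph`: a vertex `c` is adjacent to all
other vertices but one, the exceptional vertex `w` has degree 2, and the remaining vertices have
degree at most 2. -/
def HasSecondMinShape (G : SimpleGraph V) : Prop :=
  ∃ c w, w ≠ c ∧ ¬ G.Adj c w ∧ (G.neighborSet w).ncard = 2 ∧
    ∀ v, v ≠ c → v ≠ w → G.Adj c v ∧ (G.neighborSet v).ncard ≤ 2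

variable {G : SimpleGraph V} {B : G.Subgraph}

theorem HasSecondMinShape.of_iso {W : Type*} {H : SimpleGraph W} (e : G ≃g H)
    (h : HasSecondMinShape H) : HasSecondMinShape G := by
  obtain ⟨c, w, hwc, hcw, hw, hc⟩ := h
  have hn : ∀ v, (G.neighborSet v).ncard = (H.neighborSet (e v)).ncard := fun v =>
    Nat.card_congr (e.mapNeighborSet v)
  refine ⟨e.symm c, e.symm w, fun h => hwc (e.symm.injective h), ?_, ?_, fun v hv hv' => ?_⟩
  · rw [← e.map_adj_iff]; simpa using hcw
  · rw [hn]; simpa using hw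
  · have := hc (e v) (fun h => hv (by rw [← h]; simp)) (fun h => hv' (by rw [← h]; simp))
    rw [hn, ← e.map_adj_iff]
    simpa using this

theorem HasSecondMinShape.not_hasMinShape [Fintype V] (hn : 7 ≤ Fintype.card V)
    (h : HasSecondMinShape G) : ¬ HasMinShape G := by
  rintro ⟨d, hd⟩
  obtain ⟨c, w, hwc, hcw, hw, hc⟩ := h
  have hdc : d ≠ c := by
    rintro rfl
    exact hcw (hd w hwc).1
  have h1 : (G.neighborSet d).ncard ≤ 2 := by
    by_cases hdw : d = w
    · rw [hdw, hw]
    · exact (hc d hdc hdw).2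
  have h2 : ({d}ᶜ : Set V) ⊆ G.neighborSet d := fun v hv => (hd v hv).1
  have h3 := Set.ncard_le_ncard h2 (Set.toFinite _)
  rw [Set.ncard_compl, Set.ncard_singleton, Nat.card_eq_fintype_card] at h3
  omega

theorem zmod_eq_add_one_or_of_le_three {k : ℕ} (h2 : 2 ≤ k) (h3 : k ≤ 3) {i j : ZMod k}
    (h : i ≠ j) : i = j + 1 ∨ j = i + 1 := by
  interval_cases k <;> revert i j <;> decide

theorem zmod_eq_add_one_or_of_eq_four {k : ℕ} (h4 : k = 4) {i j : ZMod k}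
    (h : i ≠ j) : i = j + 1 ∨ j = i + 1 ∨ i = j + 2 := by
  subst h4
  revert i j; decide

theorem CyclicEnum.eq_of_adj (E : CyclicEnum B) {i : ZMod E.k} {z : V} (h : B.Adj (E.x i) z) :
    z = E.x (i + 1) ∨ z = E.x (i - 1) := by
  obtain ⟨j, ⟨h1, h2⟩ | ⟨h1, h2⟩⟩ := (E.adj_iff _ _).1 h
  · rw [E.inj h1]; exact Or.inl h2
  · rw [E.inj h2, add_sub_cancel_right]; exact Or.inr h1

theorem CyclicEnum.adj_x_iff (E : CyclicEnum B) {i j : ZMod E.k} :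
    B.Adj (E.x i) (E.x j) ↔ j = i + 1 ∨ i = j + 1 := by
  constructor
  · intro h
    rcases E.eq_of_adj h with h | h
    · exact Or.inl (E.inj h)
    · rw [E.inj h]; right; ring
  · rintro (rfl | rfl)
    · exact E.adj_x i
    · exact (E.adj_x j).symm

namespace BlockChart

theorem x_proj (χ : BlockChart B) {v : V} (h : v ∈ B.verts) : χ.x (χ.proj v) = v := by
  obtain ⟨i, rfl⟩ := (χ.mem_verts v).1 h
  rw [χ.proj_x]

theorem PendentAt.adj {χ : BlockChart B} {i₀ i : ZMod χ.k} (h : χ.PendentAt i₀) (hi : i ≠ i₀)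
    {z : V} (hz : G.Adj (χ.x i) z) : B.Adj (χ.x i) z := by
  refine χ.cross hz fun hp => hz.ne ?_
  rw [χ.proj_x] at hp
  have := h z (hp ▸ hi)
  rw [← hp] at this
  exact this.symm

theorem PendentAt.ncard_neighborSet_le {χ : BlockChart B} {i₀ i : ZMod χ.k}
    (h : χ.PendentAt i₀) (hi : i ≠ i₀) : (G.neighborSet (χ.x i)).ncard ≤ 2 := by
  have hsub : G.neighborSet (χ.x i) ⊆ {χ.x (i + 1), χ.x (i - 1)} := fun z hz =>
    χ.eq_of_adj (h.adj hi hz)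
  refine (Set.ncard_le_ncard hsub (Set.toFinite _)).trans ((Set.ncard_insert_le _ _).trans ?_)
  rw [Set.ncard_singleton]

theorem PendentAt.ncard_neighborSet_eq {χ : BlockChart B} {i₀ i : ZMod χ.k}
    (h : χ.PendentAt i₀) (hi : i ≠ i₀) (hk : 3 ≤ χ.k) : (G.neighborSet (χ.x i)).ncard = 2 := by
  have heq : G.neighborSet (χ.x i) = {χ.x (i + 1), χ.x (i - 1)} := by
    refine Set.Subset.antisymm (fun z hz => χ.eq_of_adj (h.adj hi hz)) ?_
    rintro z (rfl | rfl)
    · exact (χ.adj_x i).adj_sub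
    · exact (χ.adj_x_iff.2 (Or.inr (by ring))).adj_sub
  rw [heq, Set.ncard_pair]
  intro hx
  have h2 : (2 : ZMod χ.k) = 0 := by
    have := χ.inj hx
    linear_combination this
  rw [two_eq_zero_iff χ.two_le] at h2
  omega

/-- If the rest of the graph is attached to the vertex number `i₀` of the block, then this vertex
has an edge outside the block. -/
theorem PendentAt.exists_adj [Fintype V] {χ : BlockChart B} {i₀ : ZMod χ.k} (h : χ.PendentAt i₀)
    (hk : χ.k < Fintype.card V) : ∃ z, G.Adj (χ.x i₀) z ∧ ¬ B.Adj (χ.x i₀) z := by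
  have := χ.neZero
  obtain ⟨v, hv⟩ : ∃ v, v ≠ χ.x (χ.proj v) := by
    by_contra hcon
    push Not at hcon
    have hsurj : Function.Surjective χ.x := fun v => ⟨_, (hcon v).symm⟩
    have := Fintype.card_le_of_surjective _ hsurj
    rw [ZMod.card] at this
    omega
  have hvi : χ.proj v = i₀ := by
    by_contra hne
    exact hv (h v hne)
  have hr := χ.reach v
  rw [hvi] at hr hv
  obtain ⟨p⟩ := hr.symm
  cases p with
  | nil => exact absurd rfl hv
  | cons h q => exact ⟨_, h.1, h.2⟩

end BlockChart

/-- If all blocks are pendent, then they are all attached to a common vertex. -/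
theorem exists_common_center [Fintype V] (hG : G.Connected) (hn : 2 ≤ Fintype.card V)
    (χ : ∀ B : {B : G.Subgraph // IsBlock B}, BlockChart B.1)
    (cen : ∀ B, ZMod (χ B).k) (hcen : ∀ B, (χ B).PendentAt (cen B))
    (hk : ∀ B, (χ B).k < Fintype.card V) :
    ∃ c, ∀ v, v ≠ c → ∃ B, ∃ i, i ≠ cen B ∧ (χ B).x (cen B) = c ∧ (χ B).x i = v := by
  have : Nontrivial V := Fintype.one_lt_card_iff_nontrivial.1 (by omega)
  obtain ⟨a, b, hab⟩ : ∃ a b, G.Adj a b := by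
    obtain ⟨a⟩ := hG.nonempty
    exact ⟨a, hG.preconnected.exists_adj_of_nontrivial a⟩
  obtain ⟨B₀, hB₀, -⟩ := exists_isBlock_adj hab
  have hstep : ∀ B z, G.Adj ((χ ⟨B₀, hB₀⟩).x (cen ⟨B₀, hB₀⟩)) z →
      B.1.Adj ((χ ⟨B₀, hB₀⟩).x (cen ⟨B₀, hB₀⟩)) z →
      (χ B).x (cen B) = (χ ⟨B₀, hB₀⟩).x (cen ⟨B₀, hB₀⟩) := by
    intro B z hz hBz
    by_contra hne
    obtain ⟨i, hi⟩ := ((χ B).mem_verts _).1 hBz.fst_mem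
    have hic : i ≠ cen B := fun h => hne (h ▸ hi)
    obtain ⟨y, hy, hBy⟩ := (hcen ⟨B₀, hB₀⟩).exists_adj (hk _)
    have h1 := (χ ⟨B₀, hB₀⟩).adj_x (cen ⟨B₀, hB₀⟩)
    rw [← hi] at h1 hy hBy
    have h2 := (hcen B).adj hic h1.adj_sub
    have h3 := B.2.eq_of_adj hB₀ h2 h1
    exact hBy (h3 ▸ (hcen B).adj hic hy)
  generalize (χ ⟨B₀, hB₀⟩).x (cen ⟨B₀, hB₀⟩) = c at hstep
  refine ⟨c, fun v hv => ?_⟩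
  have hP : ∀ {a b : V} (_ : G.Walk a b), (a = c ∨ ∃ B, (χ B).x (cen B) = c ∧ a ∈ B.1.verts) →
      (b = c ∨ ∃ B, (χ B).x (cen B) = c ∧ b ∈ B.1.verts) := by
    intro a b p
    induction p with
    | nil => exact id
    | @cons a d b h q ih =>
      intro ha
      refine ih (Or.inr ?_)
      by_cases hac : a = c
      · subst hac
        obtain ⟨B, hB, hBad⟩ := exists_isBlock_adj h
        exact ⟨⟨B, hB⟩, hstep ⟨B, hB⟩ d h hBad, hBad.snd_mem⟩
      · obtain ⟨B, hBc, haB⟩ := ha.resolve_left hac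
        obtain ⟨i, rfl⟩ := ((χ B).mem_verts _).1 haB
        have hi : i ≠ cen B := fun hi => hac (hi ▸ hBc)
        exact ⟨B, hBc, ((hcen B).adj hi h).snd_mem⟩
  obtain ⟨p⟩ := hG.preconnected c v
  obtain ⟨B, hBc, hvB⟩ := (hP p (Or.inl rfl)).resolve_left hv
  obtain ⟨i, rfl⟩ := ((χ B).mem_verts _).1 hvB
  exact ⟨B, i, fun hi => hv (hi ▸ hBc), hBc, rfl⟩

theorem hasMinShape_of_pendent [Fintype V] (hG : G.Connected) (hn : 7 ≤ Fintype.card V)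
    (χ : ∀ B : {B : G.Subgraph // IsBlock B}, BlockChart B.1)
    (h : ∀ B, (χ B).k ≤ 3 ∧ (χ B).Pendent) : HasMinShape G := by
  choose hk cen hcen using h
  obtain ⟨c, hc⟩ := exists_common_center hG (by omega) χ cen hcen
    fun B => (hk B).trans_lt (by omega)
  refine ⟨c, fun v hv => ?_⟩
  obtain ⟨B, i, hi, rfl, rfl⟩ := hc v hv
  exact ⟨((χ B).adj_x_iff.2 (zmod_eq_add_one_or_of_le_three (χ B).two_le (hk B) hi)).adj_sub,
    BlockChart.PendentAt.ncard_neighborSet_le (hcen B) hi⟩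

theorem hasSecondMinShape_of_pendent [Fintype V] (hG : G.Connected) (hn : 7 ≤ Fintype.card V)
    (χ : ∀ B : {B : G.Subgraph // IsBlock B}, BlockChart B.1)
    (h : ∀ B, (χ B).k ≤ 4 ∧ (χ B).Pendent) {B₁ : {B : G.Subgraph // IsBlock B}}
    (h₁ : ∀ B, (χ B).k = 4 ↔ B = B₁) : HasSecondMinShape G := by
  choose hk cen hcen using h
  obtain ⟨c, hc⟩ := exists_common_center hG (by omega) χ cen hcen
    fun B => (hk B).trans_lt (by omega)
  have hk₁ : (χ B₁).k = 4 := (h₁ B₁).2 rfl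
  have h2 : (2 : ZMod (χ B₁).k) ≠ 0 := by
    rw [Ne, two_eq_zero_iff (χ B₁).two_le]; omega
  have hcB₁ : (χ B₁).x (cen B₁) = c := by
    by_contra hne
    obtain ⟨B, i, hi, hBc, hv⟩ := hc _ hne
    have hadj := (χ B₁).adj_x (cen B₁)
    rw [← hv] at hadj
    have hB : B = B₁ :=
      Subtype.ext (B.2.eq_of_adj B₁.2 (BlockChart.PendentAt.adj (hcen B) hi hadj.adj_sub) hadj)
    exact hne (hB ▸ hBc)
  have hwc : cen B₁ + 2 ≠ cen B₁ := by simpa using h2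
  refine ⟨c, (χ B₁).x (cen B₁ + 2), ?_, ?_, ?_, fun v hvc hvw => ?_⟩
  · rw [← hcB₁]
    exact fun h => hwc ((χ B₁).inj h)
  · intro hadj
    have := BlockChart.PendentAt.adj (hcen B₁) hwc hadj.symm
    rw [← hcB₁, (χ B₁).adj_x_iff] at this
    have hne : ∀ (k : ℕ) (i : ZMod k), k = 4 → ¬ (i = i + 2 + 1 ∨ i + 2 = i + 1) := by
      rintro k i rfl
      revert i; decide
    exact hne _ _ hk₁ this
  · exact BlockChart.PendentAt.ncard_neighborSet_eq (hcen B₁) hwc (by omega)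
  · obtain ⟨B, i, hi, rfl, rfl⟩ := hc v hvc
    refine ⟨?_, BlockChart.PendentAt.ncard_neighborSet_le (hcen B) hi⟩
    refine (((χ B).adj_x_iff (i := cen B)).2 ?_).adj_sub
    by_cases hB : B = B₁
    · subst hB
      rcases zmod_eq_add_one_or_of_eq_four hk₁ hi with h | h | h
      · exact Or.inl h
      · exact Or.inr h
      · exact absurd (congrArg _ h) hvw
    · have : (χ B).k ≤ 3 := by
        have h4 := hk B
        have h5 : (χ B).k ≠ 4 := fun h => hB ((h₁ B).1 h)
        omega
      exact zmod_eq_add_one_or_of_le_three (χ B).two_le this hi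

/-- A neighbour of `c` with a projection different from that of `c` belongs to the block, as does
`c`. -/
theorem BlockChart.eq_of_adj_center (χ : BlockChart B) {c v : V} (h : G.Adj c v)
    (hv : χ.proj v ≠ χ.proj c) :
    v = χ.x (χ.proj v) ∧ c = χ.x (χ.proj c) ∧
      (χ.proj v = χ.proj c + 1 ∨ χ.proj c = χ.proj v + 1) := by
  have hB := χ.cross h hv.symm
  have h1 := χ.x_proj hB.fst_mem
  have h2 := χ.x_proj hB.snd_mem
  refine ⟨h2.symm, h1.symm, ?_⟩
  rw [← χ.adj_x_iff, h1, h2]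
  exact hB

theorem HasMinShape.pendent (h : HasMinShape G) (χ : BlockChart B) : χ.k ≤ 3 ∧ χ.Pendent := by
  classical
  have := χ.neZero
  obtain ⟨c, hc⟩ := h
  refine ⟨?_, χ.proj c, fun v hv => ?_⟩
  · have huniv : (Finset.univ : Finset (ZMod χ.k)) ⊆
        {χ.proj c, χ.proj c + 1, χ.proj c - 1} := by
      intro i _
      by_cases hi : i = χ.proj c
      · simp [hi]
      · have hne : χ.x i ≠ c := fun h => hi (by rw [← h, χ.proj_x])
        have h1 := χ.eq_of_adj_center (hc _ hne).1 (by rwa [χ.proj_x])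
        rw [χ.proj_x] at h1
        rcases h1.2.2 with h | h
        · simp [h]
        · simp [h]
    have h1 := Finset.card_le_card huniv
    rw [Finset.card_univ, ZMod.card] at h1
    exact h1.trans Finset.card_le_three
  · have hne : v ≠ c := fun h => hv (by rw [h])
    exact (χ.eq_of_adj_center (hc v hne).1 hv).1

theorem HasSecondMinShape.pendent (h : HasSecondMinShape G) (χ : BlockChart B) :
    χ.k ≤ 4 ∧ χ.Pendent := by
  classical
  have := χ.neZero
  obtain ⟨c, w, hwc, hcw, hw, hc⟩ := h
  refine ⟨?_, χ.proj c, fun v hv => ?_⟩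
  · have huniv : (Finset.univ : Finset (ZMod χ.k)) ⊆
        {χ.proj c, χ.proj c + 1, χ.proj c - 1, χ.proj w} := by
      intro i _
      by_cases hi : i = χ.proj c
      · simp [hi]
      · by_cases hiw : χ.x i = w
        · rw [← hiw, χ.proj_x]; simp
        have hne : χ.x i ≠ c := fun h => hi (by rw [← h, χ.proj_x])
        have h1 := χ.eq_of_adj_center (hc _ hne hiw).1 (by rwa [χ.proj_x])
        rw [χ.proj_x] at h1
        rcases h1.2.2 with h | h
        · simp [h]
        · simp [h]
    have h1 := Finset.card_le_card huniv
    rw [Finset.card_univ, ZMod.card] at h1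
    exact h1.trans Finset.card_le_four
  · have hne : v ≠ c := fun h => hv (by rw [h])
    by_cases hvw : v = w
    · subst hvw
      -- Otherwise `w` and its two neighbours have the same projection, a vertex of the block
      -- with which both neighbours coincide.
      by_contra hx
      obtain ⟨a, b, hab, hN⟩ := Set.ncard_eq_two.1 hw
      have key : ∀ z, G.Adj v z → z = χ.x (χ.proj v) := by
        intro z hz
        have hp : χ.proj v = χ.proj z := by
          by_contra hp
          exact hx (χ.x_proj (χ.cross hz hp).fst_mem).symm
        have hzc : z ≠ c := fun h => hcw (h ▸ hz.symm)
        rw [hp]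
        exact (χ.eq_of_adj_center (hc z hzc hz.ne.symm).1 (hp ▸ hv)).1
      have ha : G.Adj v a := by
        have : a ∈ G.neighborSet v := by rw [hN]; simp
        exact this
      have hb : G.Adj v b := by
        have : b ∈ G.neighborSet v := by rw [hN]; simp
        exact this
      exact hab ((key a ha).trans (key b hb).symm)
    · exact (χ.eq_of_adj_center (hc v hne hvw).1 hv).1

theorem HasSecondMinShape.block_unique (h : HasSecondMinShape G) {B₁ B₂ : G.Subgraph}
    (hB₁ : IsBlock B₁) (hB₂ : IsBlock B₂) (χ₁ : BlockChart B₁) (χ₂ : BlockChart B₂)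
    (h₁ : χ₁.k = 4) (h₂ : χ₂.k = 4) : B₁ = B₂ := by
  classical
  obtain ⟨c, w, hwc, hcw, hw, hc⟩ := h
  obtain ⟨a, ha⟩ := Set.nonempty_of_ncard_ne_zero (s := G.neighborSet w) (by omega)
  have key : ∀ {B : G.Subgraph} (χ : BlockChart B), χ.k = 4 → B.Adj w a := by
    intro B χ hk
    have := χ.neZero
    have hp := HasSecondMinShape.pendent ⟨c, w, hwc, hcw, hw, hc⟩ χ
    -- The vertex opposite to `c` in a 4-cycle must be `w`.
    have hne2 : ∀ i : ZMod χ.k, i + 2 ≠ i ∧ ¬ (i + 2 = i + 1 ∨ i = i + 2 + 1) := by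
      have : ∀ (k : ℕ), k = 4 → ∀ i : ZMod k, i + 2 ≠ i ∧ ¬ (i + 2 = i + 1 ∨ i = i + 2 + 1) := by
        rintro k rfl; decide
      exact this _ hk
    have hxw : χ.x (χ.proj c + 2) = w := by
      by_contra hne
      have hxc : χ.x (χ.proj c + 2) ≠ c := fun h => (hne2 (χ.proj c)).1 (by
        have := χ.proj_x (χ.proj c + 2)
        rw [h] at this
        exact this.symm)
      have := χ.eq_of_adj_center (hc _ hxc hne).1 (by rw [χ.proj_x]; exact (hne2 _).1)
      rw [χ.proj_x] at this
      exact (hne2 _).2 this.2.2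
    have hpend : χ.PendentAt (χ.proj c) := by
      intro v hv
      by_cases hvw : v = w
      · rw [hvw, ← hxw, χ.proj_x]
      · exact (χ.eq_of_adj_center (hc v (fun h => hv (by rw [h])) hvw).1 hv).1
    have := hpend.adj (hne2 _).1 (z := a) (by rw [hxw]; exact ha)
    rwa [hxw] at this
  exact hB₁.eq_of_adj hB₂ (key χ₁ h₁) (key χ₂ h₂)

end Shape

/-! ### The extremal values -/

section Extremal

variable {V : Type*} [Fintype V] {G : SimpleGraph V}

theorem HasMinShape.degreeResistanceDistance_eq (hG : IsCactus G) (h : HasMinShape G) :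
    degreeResistanceDistance G = minValue (Fintype.card V) (numCycles G) := by
  classical
  have χ : ∀ B : {B : G.Subgraph // IsBlock B}, BlockChart B.1 := fun B =>
    (hG.nonempty_blockChart B.2).some
  rw [hG.degreeResistanceDistance_eq χ, Finset.sum_eq_zero, add_zero]
  exact fun B _ => (χ B).excess_eq_zero hG.sum_degrees (h.pendent (χ B)).1 (h.pendent (χ B)).2

theorem le_degreeResistanceDistance (hG : IsCactus G) (hn : 7 ≤ Fintype.card V)
    (ht : 1 ≤ numCycles G) (htn : numCycles G ≤ Fintype.card V) (h : ¬ HasMinShape G) :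
    minValue (Fintype.card V) (numCycles G) + gap (Fintype.card V) (numCycles G)
        ≤ degreeResistanceDistance G ∧
      (degreeResistanceDistance G
          = minValue (Fintype.card V) (numCycles G) + gap (Fintype.card V) (numCycles G) →
        HasSecondMinShape G) := by
  classical
  have χ : ∀ B : {B : G.Subgraph // IsBlock B}, BlockChart B.1 := fun B =>
    (hG.nonempty_blockChart B.2).some
  have hdeg := hG.sum_degrees
  have ht' : (1 : ℝ) ≤ numCycles G := by exact_mod_cast ht
  have hn' : (7 : ℝ) ≤ Fintype.card V := by exact_mod_cast hn
  have htn' : (numCycles G : ℝ) ≤ Fintype.card V := by exact_mod_cast htn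
  have hgap := gap_pos hn' ht'
  have hsplit : ∀ B, ((χ B).k ≤ 3 ∧ (χ B).Pendent ∧ (χ B).excess (numCycles G) = 0) ∨
      ((χ B).k = 4 ∧ (χ B).Pendent ∧
        (χ B).excess (numCycles G) = gap (Fintype.card V) (numCycles G)) ∨
      gap (Fintype.card V) (numCycles G) < (χ B).excess (numCycles G) := by
    intro B
    by_cases hB : (χ B).k ≤ 4 ∧ (χ B).Pendent
    · rcases hB.1.eq_or_lt with hk | hk
      · exact Or.inr (Or.inl ⟨hk, hB.2, (χ B).excess_eq_gap hdeg hk hB.2⟩)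
      · exact Or.inl ⟨by omega, hB.2, (χ B).excess_eq_zero hdeg (by omega) hB.2⟩
    · exact Or.inr (Or.inr ((χ B).gap_lt_excess hdeg hn ht' htn' hB))
  have hnonneg : ∀ B, 0 ≤ (χ B).excess (numCycles G) := by
    intro B
    rcases hsplit B with h | h | h <;> linarith [h]
  obtain ⟨B₁, hB₁⟩ : ∃ B, ¬ ((χ B).k ≤ 3 ∧ (χ B).Pendent) := by
    by_contra hcon
    push Not at hcon
    exact h (hasMinShape_of_pendent hG.1 hn χ hcon)
  have hge : ∀ B, ¬ ((χ B).k ≤ 3 ∧ (χ B).Pendent) →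
      gap (Fintype.card V) (numCycles G) ≤ (χ B).excess (numCycles G) := by
    intro B hB
    rcases hsplit B with h | h | h
    · exact absurd ⟨h.1, h.2.1⟩ hB
    · exact h.2.2.ge
    · exact h.le
  have hsum : (χ B₁).excess (numCycles G) + ∑ B ∈ Finset.univ.erase B₁,
      (χ B).excess (numCycles G) = ∑ B, (χ B).excess (numCycles G) :=
    Finset.add_sum_erase _ (fun B => (χ B).excess (numCycles G)) (Finset.mem_univ B₁)
  have hrest : 0 ≤ ∑ B ∈ Finset.univ.erase B₁, (χ B).excess (numCycles G) :=
    Finset.sum_nonneg fun B _ => hnonneg B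
  rw [hG.degreeResistanceDistance_eq χ]
  refine ⟨by linarith [hge B₁ hB₁], fun heq => ?_⟩
  have h1 : (χ B₁).excess (numCycles G) = gap (Fintype.card V) (numCycles G) := by
    linarith [hge B₁ hB₁]
  have h2 : ∑ B ∈ Finset.univ.erase B₁, (χ B).excess (numCycles G) = 0 := by linarith
  rw [Finset.sum_eq_zero_iff_of_nonneg fun B _ => hnonneg B] at h2
  have h3 : ∀ B, B ≠ B₁ → (χ B).k ≤ 3 ∧ (χ B).Pendent := by
    intro B hB
    by_contra hcon
    have := h2 B (Finset.mem_erase.2 ⟨hB, Finset.mem_univ _⟩)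
    linarith [hge B hcon]
  have h4 : (χ B₁).k = 4 ∧ (χ B₁).Pendent := by
    rcases hsplit B₁ with h | h | h
    · exact absurd ⟨h.1, h.2.1⟩ hB₁
    · exact ⟨h.1, h.2.1⟩
    · linarith
  refine hasSecondMinShape_of_pendent hG.1 hn χ (B₁ := B₁) (fun B => ?_) (fun B => ?_)
  · by_cases hB : B = B₁
    · rw [hB]; exact ⟨h4.1.le, h4.2⟩
    · exact ⟨(h3 B hB).1.trans (by norm_num), (h3 B hB).2⟩
  · constructor
    · intro hk
      by_contra hB
      have := (h3 B hB).1
      omega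
    · rintro rfl
      exact h4.1

theorem HasSecondMinShape.degreeResistanceDistance_eq (hG : IsCactus G)
    (hn : 7 ≤ Fintype.card V) (h : HasSecondMinShape G) :
    degreeResistanceDistance G
      = minValue (Fintype.card V) (numCycles G) + gap (Fintype.card V) (numCycles G) := by
  classical
  have χ : ∀ B : {B : G.Subgraph // IsBlock B}, BlockChart B.1 := fun B =>
    (hG.nonempty_blockChart B.2).some
  have hdeg := hG.sum_degrees
  obtain ⟨B₁, hB₁⟩ : ∃ B, ¬ ((χ B).k ≤ 3 ∧ (χ B).Pendent) := by
    by_contra hcon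
    push Not at hcon
    exact h.not_hasMinShape hn (hasMinShape_of_pendent hG.1 hn χ hcon)
  have hk₁ : (χ B₁).k = 4 := by
    have h1 := h.pendent (χ B₁)
    have h2 : ¬ (χ B₁).k ≤ 3 := fun h3 => hB₁ ⟨h3, h1.2⟩
    omega
  rw [hG.degreeResistanceDistance_eq χ, Finset.sum_eq_single B₁,
    (χ B₁).excess_eq_gap hdeg hk₁ (h.pendent _).2]
  · intro B _ hB
    refine (χ B).excess_eq_zero hdeg ?_ (h.pendent _).2
    have h1 := (h.pendent (χ B)).1
    have h2 : (χ B).k ≠ 4 := fun hk =>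
      hB (Subtype.ext (h.block_unique B.2 B₁.2 (χ B) (χ B₁) hk hk₁))
    omega
  · simp

end Extremal

/-! ### Graphs with the extremal shapes are isomorphic -/

section Iso

theorem exists_matching_enum {V : Type*} [Finite V] (M : SimpleGraph V)
    (hM : ∀ v x y, M.Adj v x → M.Adj v y → x = y) {s : ℕ} (hs : M.edgeSet.ncard = s) [Nonempty V] :
    ∃ a b : ℕ → V, (∀ i < s, M.Adj (a i) (b i)) ∧
      (∀ u v, M.Adj u v → ∃ i < s, (u = a i ∧ v = b i) ∨ (u = b i ∧ v = a i)) ∧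
      (∀ i < s, ∀ j < s, a i ≠ b j) ∧ (∀ i < s, ∀ j < s, a i = a j → i = j) ∧
      (∀ i < s, ∀ j < s, b i = b j → i = j) := by
  classical
  have hcard : Nat.card M.edgeSet = s := hs
  let e : M.edgeSet ≃ Fin s := Finite.equivFinOfCardEq hcard
  have hex : ∀ i : ℕ, ∃ p : V × V, ∀ h : i < s, (e.symm ⟨i, h⟩ : Sym2 V) = s(p.1, p.2) := by
    intro i
    by_cases h : i < s
    · induction hp : (e.symm ⟨i, h⟩ : Sym2 V) with
      | _ x y => exact ⟨(x, y), fun _ => hp⟩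
    · exact ⟨(Classical.arbitrary V, Classical.arbitrary V), fun h' => absurd h' h⟩
  choose p hp using hex
  have hadj : ∀ i < s, M.Adj (p i).1 (p i).2 := by
    intro i hi
    rw [← mem_edgeSet, ← hp i hi]
    exact (e.symm ⟨i, hi⟩).2
  have huniq : ∀ i < s, ∀ j < s, s((p i).1, (p i).2) = s((p j).1, (p j).2) → i = j := by
    intro i hi j hj h
    rw [← hp i hi, ← hp j hj] at h
    have := e.symm.injective (Subtype.ext h)
    simpa using this
  refine ⟨fun i => (p i).1, fun i => (p i).2, hadj, ?_, ?_, ?_, ?_⟩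
  · intro u v huv
    refine ⟨e ⟨s(u, v), huv⟩, (e ⟨s(u, v), huv⟩).2, ?_⟩
    have := hp _ (e ⟨s(u, v), huv⟩).2
    simp only [Fin.eta, Equiv.symm_apply_apply] at this
    rwa [Sym2.eq_iff] at this
  · intro i hi j hj h
    dsimp only at h
    have h1 := hadj i hi
    have h2 := (hadj j hj).symm
    rw [← h] at h2
    have h3 := hM _ _ _ h1 h2
    have h4 := huniq i hi j hj (by rw [h3, h, Sym2.eq_swap])
    subst h4
    exact h1.ne h
  · intro i hi j hj h
    dsimp only at h
    have h1 := hadj i hi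
    have h2 := hadj j hj
    rw [← h] at h2
    exact huniq i hi j hj (by rw [hM _ _ _ h1 h2, h])
  · intro i hi j hj h
    dsimp only at h
    have h1 := (hadj i hi).symm
    have h2 := (hadj j hj).symm
    rw [← h] at h2
    exact huniq i hi j hj (by rw [hM _ _ _ h1 h2, h])

/-- The sequence `c, a 0, b 0, a 1, b 1, …`. -/
def interleave {V : Type*} (c : V) (a b : ℕ → V) (j : ℕ) : V :=
  if j = 0 then c else if j % 2 = 1 then a (j / 2) else b (j / 2 - 1)

theorem interleave_odd {V : Type*} (c : V) (a b : ℕ → V) (i : ℕ) :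
    interleave c a b (2 * i + 1) = a i := by
  unfold interleave
  rw [if_neg (by omega), if_pos (by omega)]
  congr 1; omega

theorem interleave_even {V : Type*} (c : V) (a b : ℕ → V) (i : ℕ) :
    interleave c a b (2 * i + 2) = b i := by
  unfold interleave
  rw [if_neg (by omega), if_neg (by omega)]
  congr 1; omega

/-- A numbering of the vertices that starts with a given sequence `c, a 0, b 0, a 1, b 1, …` of
distinct vertices. -/
theorem exists_perm_interleave {n N : ℕ} (hN : N < n) (c : Fin n) (a b : ℕ → Fin n)
    (hca : ∀ i, 2 * i + 1 ≤ N → a i ≠ c) (hcb : ∀ i, 2 * i + 2 ≤ N → b i ≠ c)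
    (hab : ∀ i j, 2 * i + 1 ≤ N → 2 * j + 2 ≤ N → a i ≠ b j)
    (ha : ∀ i j, 2 * i + 1 ≤ N → 2 * j + 1 ≤ N → a i = a j → i = j)
    (hb : ∀ i j, 2 * i + 2 ≤ N → 2 * j + 2 ≤ N → b i = b j → i = j) :
    ∃ σ : Equiv.Perm (Fin n), σ ⟨0, by omega⟩ = c ∧
      (∀ i (h : 2 * i + 1 ≤ N), σ ⟨2 * i + 1, by omega⟩ = a i) ∧
      (∀ i (h : 2 * i + 2 ≤ N), σ ⟨2 * i + 2, by omega⟩ = b i) := by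
  have hform : ∀ j : ℕ, j = 0 ∨ (∃ i, j = 2 * i + 1) ∨ ∃ i, j = 2 * i + 2 := by
    intro j
    rcases Nat.eq_zero_or_pos j with h | h
    · exact Or.inl h
    · rcases Nat.mod_two_eq_zero_or_one j with h' | h'
      · exact Or.inr (Or.inr ⟨j / 2 - 1, by omega⟩)
      · exact Or.inr (Or.inl ⟨j / 2, by omega⟩)
  have hinj : ∀ i j : ℕ, i ≤ N → j ≤ N → interleave c a b i = interleave c a b j → i = j := by
    have h0 : interleave c a b 0 = c := by simp [interleave]
    intro i j hi hj h
    rcases hform i with rfl | ⟨i, rfl⟩ | ⟨i, rfl⟩ <;> rcases hform j with rfl | ⟨j, rfl⟩ | ⟨j, rfl⟩ <;>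
      simp only [h0, interleave_odd, interleave_even] at h
    · rfl
    · exact absurd h.symm (hca j hj)
    · exact absurd h.symm (hcb j hj)
    · exact absurd h (hca i hi)
    · rw [ha i j hi hj h]
    · exact absurd h (hab i j hi hj)
    · exact absurd h (hcb i hi)
    · exact absurd h.symm (hab j i hj hi)
    · rw [hb i j hi hj h]
  obtain ⟨g, hg⟩ := Finset.exists_equiv_extend_of_card_eq (α := Fin n) (β := Fin n)
    (t := Finset.univ) (by simp) (s := Finset.univ.filter fun j => j.val ≤ N)
    (f := fun j => interleave c a b j.val) (Finset.subset_univ _) (by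
      intro i hi j hj h
      simp only [Finset.coe_filter, Finset.mem_univ, true_and, Set.mem_ofPred_eq] at hi hj
      exact Fin.ext (hinj _ _ hi hj h))
  refine ⟨g.trans (Equiv.subtypeUnivEquiv (fun x => Finset.mem_univ x)), ?_, ?_, ?_⟩
  · have := hg ⟨0, by omega⟩ (by simp)
    simpa [interleave] using this
  · intro i hi
    have := hg ⟨2 * i + 1, by omega⟩ (by simpa using hi)
    simpa [interleave_odd] using this
  · intro i hi
    have := hg ⟨2 * i + 2, by omega⟩ (by simpa using hi)
    simpa [interleave_even] using this

theorem eq_of_ncard_neighborSet_le_two {V : Type*} [Finite V] {G : SimpleGraph V} {v c x y : V}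
    (h : (G.neighborSet v).ncard ≤ 2) (hc : G.Adj v c) (hx : G.Adj v x) (hy : G.Adj v y)
    (hxc : x ≠ c) (hyc : y ≠ c) : x = y := by
  by_contra hxy
  have hsub : ({c, x, y} : Set V) ⊆ G.neighborSet v := by
    rintro z (rfl | rfl | rfl)
    · exact hc
    · exact hx
    · exact hy
  have h1 := Set.ncard_le_ncard hsub (Set.toFinite _)
  rw [Set.ncard_eq_three.2 ⟨c, x, y, hxc.symm, hyc.symm, hxy, rfl⟩] at h1
  omega

theorem ncard_edgeSet_deleteIncidenceSet {V : Type*} [Finite V] (G : SimpleGraph V) (v : V) :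
    (G.deleteIncidenceSet v).edgeSet.ncard + (G.neighborSet v).ncard = G.edgeSet.ncard := by
  classical
  have := Fintype.ofFinite V
  have h1 := G.card_edgeFinset_deleteIncidenceSet v
  have h2 := G.degree_le_card_edgeFinset v
  rw [← coe_edgeFinset, ← coe_edgeFinset, Set.ncard_coe_finset, Set.ncard_coe_finset,
    ← coe_neighborFinset, Set.ncard_coe_finset, card_neighborFinset_eq_degree]
  omega

theorem HasMinShape.nonempty_iso {n t : ℕ} (hnt : 2 * t + 1 ≤ n) {G : SimpleGraph (Fin n)}
    (h : HasMinShape G) (hG : G.edgeSet.ncard + 1 = n + t) : Nonempty (G ≃g minGraph n t) := by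
  obtain ⟨c, hc⟩ := h
  have : Nonempty (Fin n) := ⟨c⟩
  have hdeg : (G.neighborSet c).ncard = n - 1 := by
    have : G.neighborSet c = {c}ᶜ := Set.Subset.antisymm
      (fun v hv => (G.ne_of_adj hv).symm) (fun v hv => (hc v hv).1)
    rw [this, Set.ncard_compl, Set.ncard_singleton, Nat.card_eq_fintype_card, Fintype.card_fin]
  have hcard := ncard_edgeSet_deleteIncidenceSet G c
  have hs : (G.deleteIncidenceSet c).edgeSet.ncard = t := by omega
  obtain ⟨a, b, hadj, hex, hab, ha, hb⟩ := exists_matching_enum (G.deleteIncidenceSet c) (by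
    intro v x y hx hy
    rw [deleteIncidenceSet_adj] at hx hy
    exact eq_of_ncard_neighborSet_le_two (hc v hx.2.1).2 (hc v hx.2.1).1.symm hx.1 hy.1
      hx.2.2 hy.2.2) hs
  simp only [deleteIncidenceSet_adj] at hadj hex
  obtain ⟨σ, h0, hσa, hσb⟩ := exists_perm_interleave (N := 2 * t) hnt c a b
    (fun i hi => (hadj i (by omega)).2.1) (fun i hi => (hadj i (by omega)).2.2)
    (fun i j hi hj => hab i (by omega) j (by omega))
    (fun i j hi hj => ha i (by omega) j (by omega))
    (fun i j hi hj => hb i (by omega) j (by omega))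
  refine ⟨(RelIso.mk σ ?_ : minGraph n t ≃g G).symm⟩
  intro x y
  have key0 : ∀ z : Fin n, σ z = c ↔ z.val = 0 := by
    intro z
    rw [← h0, σ.injective.eq_iff, Fin.ext_iff]
  have keya : ∀ (z : Fin n) i, i < t → (σ z = a i ↔ z.val = 2 * i + 1) := by
    intro z i hi
    rw [← hσa i (by omega), σ.injective.eq_iff, Fin.ext_iff]
  have keyb : ∀ (z : Fin n) i, i < t → (σ z = b i ↔ z.val = 2 * i + 2) := by
    intro z i hi
    rw [← hσb i (by omega), σ.injective.eq_iff, Fin.ext_iff]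
  have hne : x ≠ y ↔ σ x ≠ σ y := σ.injective.ne_iff.symm
  rw [minGraph, fromRel_adj, hne]
  constructor
  · intro h
    refine ⟨h.ne, ?_⟩
    by_cases hx : σ x = c
    · exact Or.inl (Or.inl ((key0 x).1 hx))
    by_cases hy : σ y = c
    · exact Or.inr (Or.inl ((key0 y).1 hy))
    obtain ⟨i, hi, ⟨h1, h2⟩ | ⟨h1, h2⟩⟩ := hex _ _ ⟨h, hx, hy⟩
    · rw [keya _ _ hi] at h1; rw [keyb _ _ hi] at h2
      left; right; omega
    · rw [keyb _ _ hi] at h1; rw [keya _ _ hi] at h2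
      right; right; omega
  · have hside : ∀ x y : Fin n, σ x ≠ σ y → (x.val = 0 ∨ (x.val % 2 = 1 ∧ y.val = x.val + 1 ∧
        y.val ≤ 2 * t)) → G.Adj (σ x) (σ y) := by
      rintro x y hxy (h | h)
      · rw [← key0] at h
        rw [h] at hxy ⊢
        exact (hc _ hxy.symm).1
      · have hi : x.val / 2 < t := by omega
        rw [(keya x _ hi).2 (by omega), (keyb y _ hi).2 (by omega)]
        exact (hadj _ hi).1
    rintro ⟨hxy, h | h⟩
    · exact hside x y hxy h
    · exact (hside y x hxy.symm h).symm

/-- In a graph of the second shape, the vertices of the 4-cycle and of the triangles are listed as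
`c, a 0, b 0, …, a (t - 1), b (t - 1), a t`; the 4-cycle is `c, a (t - 1), b (t - 1), a t`. -/
theorem HasSecondMinShape.exists_enum {n t : ℕ} (ht : 1 ≤ t) (hnt : 2 * t + 2 ≤ n)
    {G : SimpleGraph (Fin n)} (h : HasSecondMinShape G) (hG : G.edgeSet.ncard + 1 = n + t) :
    ∃ (c : Fin n) (a b : ℕ → Fin n),
      ((∀ i, 2 * i + 1 ≤ 2 * t + 1 → a i ≠ c) ∧ (∀ i, 2 * i + 2 ≤ 2 * t + 1 → b i ≠ c) ∧
        (∀ i j, 2 * i + 1 ≤ 2 * t + 1 → 2 * j + 2 ≤ 2 * t + 1 → a i ≠ b j) ∧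
        (∀ i j, 2 * i + 1 ≤ 2 * t + 1 → 2 * j + 1 ≤ 2 * t + 1 → a i = a j → i = j) ∧
        (∀ i j, 2 * i + 2 ≤ 2 * t + 1 → 2 * j + 2 ≤ 2 * t + 1 → b i = b j → i = j)) ∧
      (∀ i < t, G.Adj (a i) (b i)) ∧ G.Adj (b (t - 1)) (a t) ∧ ¬ G.Adj c (b (t - 1)) ∧
      (∀ v, v ≠ c → v ≠ b (t - 1) → G.Adj c v) ∧
      (∀ u v, G.Adj u v → u ≠ c → v ≠ c →
        (∃ i < t, (u = a i ∧ v = b i) ∨ (u = b i ∧ v = a i)) ∨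
        (u = b (t - 1) ∧ v = a t) ∨ (u = a t ∧ v = b (t - 1))) := by
  classical
  obtain ⟨c, w, hwc, hcw, hw, hc⟩ := h
  have : Nonempty (Fin n) := ⟨c⟩
  obtain ⟨p, q, hpq, hN⟩ := Set.ncard_eq_two.1 hw
  have hwz : ∀ z, G.Adj w z ↔ z = p ∨ z = q := by
    intro z
    rw [← mem_neighborSet, hN]
    rfl
  have hwp : G.Adj w p := (hwz p).2 (Or.inl rfl)
  have hwq : G.Adj w q := (hwz q).2 (Or.inr rfl)
  have hpc : p ≠ c := fun h => hcw (h ▸ hwp.symm)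
  have hqc : q ≠ c := fun h => hcw (h ▸ hwq.symm)
  have hdeg : (G.neighborSet c).ncard = n - 2 := by
    have : G.neighborSet c = {c, w}ᶜ := by
      refine Set.Subset.antisymm (fun v hv => ?_) (fun v hv => ?_)
      · rintro (rfl | rfl)
        · exact G.loopless.irrefl _ hv
        · exact hcw hv
      · have h1 : ¬ (v = c ∨ v = w) := hv
        rw [not_or] at h1
        exact (hc v h1.1 h1.2).1
    rw [this, Set.ncard_compl, Set.ncard_pair hwc.symm, Nat.card_eq_fintype_card, Fintype.card_fin]
  have hdegw : ((G.deleteIncidenceSet c).neighborSet w).ncard = 2 := by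
    rw [← hw]
    congr 1
    ext z
    rw [mem_neighborSet, mem_neighborSet, deleteIncidenceSet_adj]
    exact ⟨fun h => h.1, fun h => ⟨h, hwc, fun hz => hcw (hz ▸ h.symm)⟩⟩
  have hcard := ncard_edgeSet_deleteIncidenceSet G c
  have hcard' := ncard_edgeSet_deleteIncidenceSet (G.deleteIncidenceSet c) w
  have hs : ((G.deleteIncidenceSet c).deleteIncidenceSet w).edgeSet.ncard = t - 1 := by omega
  obtain ⟨a, b, hadj, hex, hab, ha, hb⟩ := exists_matching_enum
    ((G.deleteIncidenceSet c).deleteIncidenceSet w) (by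
      intro v x y hx hy
      simp only [deleteIncidenceSet_adj] at hx hy
      have hv := hc v hx.1.2.1 hx.2.1
      exact eq_of_ncard_neighborSet_le_two hv.2 hv.1.symm hx.1.1 hy.1.1 hx.1.2.2 hy.1.2.2) hs
  simp only [deleteIncidenceSet_adj] at hadj hex
  -- The neighbours of `w` have no neighbours besides `c` and `w`, so they are not matched.
  have hfree : ∀ u z, G.Adj w u → G.Adj u z → z ≠ c → z = w := by
    intro u z hu hz hzc
    have huc : u ≠ c := fun h => hcw (h ▸ hu.symm)
    have h := hc u huc hu.ne.symm
    exact eq_of_ncard_neighborSet_le_two h.2 h.1.symm hz hu.symm hzc hwc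
  have hanot : ∀ i < t - 1, ¬ G.Adj w (a i) := fun i hi h =>
    (hadj i hi).2.2 (hfree _ _ h (hadj i hi).1.1 (hadj i hi).1.2.2)
  have hbnot : ∀ i < t - 1, ¬ G.Adj w (b i) := fun i hi h =>
    (hadj i hi).2.1 (hfree _ _ h (hadj i hi).1.1.symm (hadj i hi).1.2.1)
  -- The 4-cycle occupies the positions `2t - 1`, `2t`, `2t + 1` after the matched pairs.
  obtain ⟨a', ha', ha'p, ha'q⟩ : ∃ a' : ℕ → Fin n, (∀ i < t - 1, a' i = a i) ∧ a' (t - 1) = p ∧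
      a' t = q := by
    refine ⟨fun i => if i < t - 1 then a i else if i = t - 1 then p else q, ?_, ?_, ?_⟩
    · intro i hi; simp [hi]
    · simp
    · simp only
      rw [if_neg (by omega), if_neg (by omega)]
  obtain ⟨b', hb', hb'w⟩ : ∃ b' : ℕ → Fin n, (∀ i < t - 1, b' i = b i) ∧ b' (t - 1) = w := by
    refine ⟨fun i => if i < t - 1 then b i else w, ?_, ?_⟩
    · intro i hi; simp [hi]
    · simp
  have hcasea : ∀ i, 2 * i + 1 ≤ 2 * t + 1 → i < t - 1 ∨ i = t - 1 ∨ i = t := by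
    intro i hi; omega
  have hcaseb : ∀ i, 2 * i + 2 ≤ 2 * t + 1 → i < t - 1 ∨ i = t - 1 := by
    intro i hi; omega
  have hap : ∀ i < t - 1, a i ≠ p := fun i hi h => hanot i hi (h ▸ hwp)
  have haq : ∀ i < t - 1, a i ≠ q := fun i hi h => hanot i hi (h ▸ hwq)
  have hbp : ∀ i < t - 1, b i ≠ p := fun i hi h => hbnot i hi (h ▸ hwp)
  have hbq : ∀ i < t - 1, b i ≠ q := fun i hi h => hbnot i hi (h ▸ hwq)
  refine ⟨c, a', b', ⟨?_, ?_, ?_, ?_, ?_⟩, ?_, ?_, ?_, ?_, ?_⟩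
  · intro i hi
    rcases hcasea i hi with h | rfl | rfl
    · rw [ha' i h]; exact (hadj i h).1.2.1
    · rwa [ha'p]
    · rwa [ha'q]
  · intro i hi
    rcases hcaseb i hi with h | rfl
    · rw [hb' i h]; exact (hadj i h).1.2.2
    · rwa [hb'w]
  · intro i j hi hj
    rcases hcaseb j hj with hj | rfl <;> rcases hcasea i hi with hi | rfl | rfl
    · rw [ha' i hi, hb' j hj]; exact hab i hi j hj
    · rw [ha'p, hb' j hj]; exact (hbp j hj).symm
    · rw [ha'q, hb' j hj]; exact (hbq j hj).symm
    · rw [ha' i hi, hb'w]; exact (hadj i hi).2.1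
    · rw [ha'p, hb'w]; exact hwp.ne.symm
    · rw [ha'q, hb'w]; exact hwq.ne.symm
  · intro i j hi hj h
    rcases hcasea i hi with hi | hi | hi <;> rcases hcasea j hj with hj | hj | hj
    · rw [ha' i hi, ha' j hj] at h; exact ha i hi j hj h
    · rw [ha' i hi, hj, ha'p] at h; exact absurd h (hap i hi)
    · rw [ha' i hi, hj, ha'q] at h; exact absurd h (haq i hi)
    · rw [ha' j hj, hi, ha'p] at h; exact absurd h.symm (hap j hj)
    · omega
    · rw [hi, hj, ha'p, ha'q] at h; exact absurd h hpq
    · rw [ha' j hj, hi, ha'q] at h; exact absurd h.symm (haq j hj)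
    · rw [hi, hj, ha'p, ha'q] at h; exact absurd h.symm hpq
    · omega
  · intro i j hi hj h
    rcases hcaseb i hi with hi | hi <;> rcases hcaseb j hj with hj | hj
    · rw [hb' i hi, hb' j hj] at h; exact hb i hi j hj h
    · rw [hb' i hi, hj, hb'w] at h; exact absurd h (hadj i hi).2.2
    · rw [hb' j hj, hi, hb'w] at h; exact absurd h.symm (hadj j hj).2.2
    · omega
  · intro i hi
    rcases (show i < t - 1 ∨ i = t - 1 by omega) with h | rfl
    · rw [ha' i h, hb' i h]; exact (hadj i h).1.1
    · rw [ha'p, hb'w]; exact hwp.symm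
  · rw [ha'q, hb'w]; exact hwq
  · rwa [hb'w]
  · intro v hvc hvw
    rw [hb'w] at hvw
    exact (hc v hvc hvw).1
  · intro u v h hu hv
    by_cases huw : u = w
    · rw [huw, hwz] at h
      rcases h with h | h
      · exact Or.inl ⟨t - 1, by omega, Or.inr ⟨by rw [huw, hb'w], by rw [h, ha'p]⟩⟩
      · exact Or.inr (Or.inl ⟨by rw [huw, hb'w], by rw [h, ha'q]⟩)
    by_cases hvw : v = w
    · rw [hvw, G.adj_comm, hwz] at h
      rcases h with h | h
      · exact Or.inl ⟨t - 1, by omega, Or.inl ⟨by rw [h, ha'p], by rw [hvw, hb'w]⟩⟩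
      · exact Or.inr (Or.inr ⟨by rw [h, ha'q], by rw [hvw, hb'w]⟩)
    obtain ⟨i, hi, hor⟩ := hex _ _ ⟨⟨h, hu, hv⟩, huw, hvw⟩
    exact Or.inl ⟨i, by omega, by rwa [ha' i hi, hb' i hi]⟩

theorem HasSecondMinShape.nonempty_iso {n t : ℕ} (ht : 1 ≤ t) (hnt : 2 * t + 2 ≤ n)
    {G : SimpleGraph (Fin n)} (h : HasSecondMinShape G) (hG : G.edgeSet.ncard + 1 = n + t) :
    Nonempty (G ≃g secondMinGraph n t) := by
  obtain ⟨c, a, b, ⟨hac, hbc, hab, ha, hb⟩, hadj, hadj', hcw, hc, hex⟩ := h.exists_enum ht hnt hG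
  obtain ⟨σ, h0, hσa, hσb⟩ := exists_perm_interleave (N := 2 * t + 1) hnt c a b hac hbc hab ha hb
  refine ⟨(RelIso.mk σ ?_ : secondMinGraph n t ≃g G).symm⟩
  intro x y
  have key0 : ∀ z : Fin n, σ z = c ↔ z.val = 0 := by
    intro z
    rw [← h0, σ.injective.eq_iff, Fin.ext_iff]
  have keya : ∀ (z : Fin n) i, i < t + 1 → (σ z = a i ↔ z.val = 2 * i + 1) := by
    intro z i hi
    rw [← hσa i (by omega), σ.injective.eq_iff, Fin.ext_iff]
  have keyb : ∀ (z : Fin n) i, i < t → (σ z = b i ↔ z.val = 2 * i + 2) := by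
    intro z i hi
    rw [← hσb i (by omega), σ.injective.eq_iff, Fin.ext_iff]
  have keyw : ∀ z : Fin n, σ z = b (t - 1) ↔ z.val = 2 * t := by
    intro z
    rw [keyb z _ (by omega)]
    omega
  have hne : x ≠ y ↔ σ x ≠ σ y := σ.injective.ne_iff.symm
  rw [secondMinGraph, fromRel_adj, hne]
  constructor
  · intro h
    refine ⟨h.ne, ?_⟩
    by_cases hx : σ x = c
    · have : y.val ≠ 2 * t := fun hy => by
        rw [← keyw] at hy
        rw [hx, hy] at h
        exact hcw h
      exact Or.inl (Or.inl ⟨(key0 x).1 hx, this⟩)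
    by_cases hy : σ y = c
    · have : x.val ≠ 2 * t := fun hx => by
        rw [← keyw] at hx
        rw [hx, hy] at h
        exact hcw h.symm
      exact Or.inr (Or.inl ⟨(key0 y).1 hy, this⟩)
    obtain ⟨i, hi, ⟨h1, h2⟩ | ⟨h1, h2⟩⟩ | ⟨h1, h2⟩ | ⟨h1, h2⟩ := hex _ _ h hx hy
    · rw [keya _ _ (by omega)] at h1; rw [keyb _ _ hi] at h2
      left; right; left; omega
    · rw [keyb _ _ hi] at h1; rw [keya _ _ (by omega)] at h2
      right; right; left; omega
    · rw [keyw] at h1; rw [keya _ _ (by omega)] at h2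
      exact Or.inl (Or.inr (Or.inr ⟨h1, h2⟩))
    · rw [keya _ _ (by omega)] at h1; rw [keyw] at h2
      exact Or.inr (Or.inr (Or.inr ⟨h2, h1⟩))
  · have hside : ∀ x y : Fin n, σ x ≠ σ y → ((x.val = 0 ∧ y.val ≠ 2 * t) ∨
        (x.val % 2 = 1 ∧ y.val = x.val + 1 ∧ y.val ≤ 2 * t) ∨
        (x.val = 2 * t ∧ y.val = 2 * t + 1)) → G.Adj (σ x) (σ y) := by
      rintro x y hxy (h | h | h)
      · rw [← key0, Ne, ← keyw] at h
        rw [h.1] at hxy ⊢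
        exact hc _ hxy.symm h.2
      · rw [(keya x (x.val / 2) (by omega)).2 (by omega),
          (keyb y (x.val / 2) (by omega)).2 (by omega)]
        exact hadj _ (by omega)
      · rw [(keyw x).2 h.1, (keya y t (by omega)).2 h.2]
        exact hadj'
    rintro ⟨hxy, h | h⟩
    · exact hside x y hxy h
    · exact (hside y x hxy.symm h).symm

end Iso

/-! ### The extremal graphs are cacti -/

section Bouquet

variable {V : Type*} {G : SimpleGraph V}

theorem exists_triangle {c a b : V} (h₁ : G.Adj c a) (h₂ : G.Adj a b) (h₃ : G.Adj b c) :
    ∃ C : G.Subgraph, IsCycleSubgraph C ∧ (∀ x, x ∈ C.verts ↔ x = c ∨ x = a ∨ x = b) ∧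
      ∀ x ∈ C.verts, ∀ y ∈ C.verts, G.Adj x y → C.Adj x y := by
  have hmem : ∀ x, x ∈ (Walk.cons h₁ (.cons h₂ (.cons h₃ .nil))).toSubgraph.verts ↔
      x = c ∨ x = a ∨ x = b := by
    intro x
    simp only [Walk.mem_verts_toSubgraph, Walk.support_cons, Walk.support_nil, List.mem_cons,
      List.not_mem_nil]
    tauto
  refine ⟨_, ⟨c, .cons h₁ (.cons h₂ (.cons h₃ .nil)), ?_, rfl⟩, hmem, fun x hx y hy hxy => ?_⟩
  · rw [Walk.cons_isCycle_iff]
    have := h₁.ne; have := h₂.ne; have := h₃.ne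
    simp_all [eq_comm]
  · rw [hmem] at hx hy
    rw [Walk.adj_toSubgraph_iff_mem_edges]
    have := hxy.ne
    rcases hx with rfl | rfl | rfl <;> rcases hy with rfl | rfl | rfl <;> simp_all

theorem exists_quadrangle {c a w b : V} (h₁ : G.Adj c a) (h₂ : G.Adj a w) (h₃ : G.Adj w b)
    (h₄ : G.Adj b c) (hcw : c ≠ w) (hab : a ≠ b) (hcw' : ¬ G.Adj c w) (hab' : ¬ G.Adj a b) :
    ∃ C : G.Subgraph, IsCycleSubgraph C ∧ (∀ x, x ∈ C.verts ↔ x = c ∨ x = a ∨ x = w ∨ x = b) ∧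
      ∀ x ∈ C.verts, ∀ y ∈ C.verts, G.Adj x y → C.Adj x y := by
  have hmem : ∀ x, x ∈ (Walk.cons h₁ (.cons h₂ (.cons h₃ (.cons h₄ .nil)))).toSubgraph.verts ↔
      x = c ∨ x = a ∨ x = w ∨ x = b := by
    intro x
    simp only [Walk.mem_verts_toSubgraph, Walk.support_cons, Walk.support_nil, List.mem_cons,
      List.not_mem_nil]
    tauto
  refine ⟨_, ⟨c, .cons h₁ (.cons h₂ (.cons h₃ (.cons h₄ .nil))), ?_, rfl⟩, hmem,
    fun x hx y hy hxy => ?_⟩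
  · rw [Walk.cons_isCycle_iff]
    have := h₁.ne; have := h₂.ne; have := h₃.ne; have := h₄.ne
    simp_all [eq_comm]
  · rw [hmem] at hx hy
    rw [Walk.adj_toSubgraph_iff_mem_edges]
    have := hxy.ne
    have := hxy.symm
    rcases hx with rfl | rfl | rfl | rfl <;> rcases hy with rfl | rfl | rfl | rfl <;> simp_all

/-- A criterion for being a cactus with `t` cycles: after the deletion of a vertex `c`, each class
of a partition into unions of components spans, together with `c`, a subgraph of one of `t` given
cycles, or is a single neighbour of `c`. -/
theorem isCactus_and_numCycles_eq [Finite V] [Nontrivial V] {ι : Type*} (hG : G.Connected) (c : V)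
    (ℓ : V → ι) (hl : ∀ u v, u ≠ c → v ≠ c → G.Adj u v → ℓ u = ℓ v) {t : ℕ}
    (C : Fin t → G.Subgraph) (hC : ∀ i, IsCycleSubgraph (C i)) (hinj : Function.Injective C)
    (hcov : ∀ v, v ≠ c →
      (∃ i, (∀ x, x = c ∨ ℓ x = ℓ v → x ∈ (C i).verts) ∧
        ∀ x y, (x = c ∨ ℓ x = ℓ v) → (y = c ∨ ℓ y = ℓ v) → G.Adj x y → (C i).Adj x y) ∨
      (G.Adj c v ∧ ∀ x, x ≠ c → ℓ x = ℓ v → x = v)) :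
    IsCactus G ∧ numCycles G = t := by
  have hedge : ∀ (H : G.Subgraph) {v : V} (h : G.Adj c v), (∀ x ∈ H.verts, x = c ∨ x = v) →
      H ≤ G.subgraphOfAdj h := by
    intro H v h hx
    refine ⟨fun x hxH => by simpa using hx x hxH, fun x y hxy => ?_⟩
    have h1 := hx x hxy.fst_mem
    have h2 := hx y hxy.snd_mem
    have h3 := hxy.adj_sub.ne
    rw [subgraphOfAdj_adj, Sym2.eq_iff]
    rcases h1 with rfl | rfl <;> rcases h2 with rfl | rfl <;> simp_all
  have key : ∀ H : G.Subgraph, IsNonseparable H →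
      (∃ i, H ≤ C i) ∨ ∃ E : G.Subgraph, IsEdgeSubgraph E ∧ H ≤ E := by
    intro H hH
    by_cases hv : ∃ v ∈ H.verts, v ≠ c
    · obtain ⟨v, hvH, hvc⟩ := hv
      -- As `H` has no cut vertex, it lies in a single class together with `c`.
      have hwalk : ∀ {x y : V} (p : G.Walk x y), c ∉ p.support → ℓ x = ℓ y := by
        intro x y p
        induction p with
        | nil => exact fun _ => rfl
        | @cons x z y h q ih =>
          intro hc
          rw [Walk.support_cons, List.mem_cons, not_or] at hc
          exact (hl x z (Ne.symm hc.1) (fun hz => hc.2 (hz ▸ q.start_mem_support)) h).trans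
            (ih hc.2)
      have hcls : ∀ x ∈ H.verts, x = c ∨ ℓ x = ℓ v := by
        intro x hx
        rw [or_iff_not_imp_left]
        intro hxc
        obtain ⟨p, -, hp⟩ := (isNonseparable_iff.1 hH).2 c x v hx hvH hxc hvc
        exact hwalk p hp
      rcases hcov v hvc with ⟨i, hi, hadj⟩ | ⟨h, hx⟩
      · exact Or.inl ⟨i, fun x hx => hi x (hcls x hx), fun x y hxy =>
          hadj x y (hcls x hxy.fst_mem) (hcls y hxy.snd_mem) hxy.adj_sub⟩
      · refine Or.inr ⟨_, ⟨c, v, h, rfl⟩, hedge H h fun x hxH => ?_⟩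
        by_cases hxc : x = c
        · exact Or.inl hxc
        · exact Or.inr (hx x hxc ((hcls x hxH).resolve_left hxc))
    · push Not at hv
      obtain ⟨u, hu⟩ := hG.preconnected.exists_adj_of_nontrivial c
      exact Or.inr ⟨_, ⟨c, u, hu, rfl⟩, hedge H hu fun x hx => Or.inl (hv x hx)⟩
  refine ⟨⟨hG, fun B hB => ?_⟩, ?_⟩
  · rcases key B hB.1 with ⟨i, hi⟩ | ⟨E, hE, hle⟩
    · right
      rw [le_antisymm hi (hB.2 (hC i).isNonseparable hi)]
      exact hC i
    · left
      rw [le_antisymm hle (hB.2 hE.isNonseparable hle)]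
      exact hE
  · have : {D : G.Subgraph | IsCycleSubgraph D} = Set.range C := by
      ext D
      constructor
      · intro hD
        rcases key D hD.isNonseparable with ⟨i, hi⟩ | ⟨E, hE, hle⟩
        · exact ⟨i, (hD.eq_of_le (hC i) hi).symm⟩
        · exact absurd hle (hD.not_le_edge hE)
      · rintro ⟨i, rfl⟩
        exact hC i
    rw [numCycles, this, ← Set.image_univ, (hinj.injOn).ncard_image, Set.ncard_univ, Nat.card_fin]

theorem connected_of_forall_reachable (c : V) (h : ∀ v, G.Reachable c v) : G.Connected :=
  have : Nonempty V := ⟨c⟩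
  ⟨fun u v => (h u).symm.trans (h v)⟩

theorem ncard_neighborSet_le_two {v a b : V} (h : ∀ z, G.Adj v z → z = a ∨ z = b) :
    (G.neighborSet v).ncard ≤ 2 := by
  refine (Set.ncard_le_ncard (t := {a, b}) h (Set.toFinite _)).trans
    ((Set.ncard_insert_le _ _).trans ?_)
  rw [Set.ncard_singleton]

end Bouquet

section Concrete

variable {n t : ℕ}

theorem minGraph_adj {i j : Fin n} : (minGraph n t).Adj i j ↔ i.val ≠ j.val ∧
    ((i.val = 0 ∨ (i.val % 2 = 1 ∧ j.val = i.val + 1 ∧ j.val ≤ 2 * t)) ∨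
      (j.val = 0 ∨ (j.val % 2 = 1 ∧ i.val = j.val + 1 ∧ i.val ≤ 2 * t))) := by
  rw [minGraph, fromRel_adj, Ne, Fin.ext_iff]

theorem secondMinGraph_adj {i j : Fin n} : (secondMinGraph n t).Adj i j ↔ i.val ≠ j.val ∧
    (((i.val = 0 ∧ j.val ≠ 2 * t) ∨ (i.val % 2 = 1 ∧ j.val = i.val + 1 ∧ j.val ≤ 2 * t) ∨
      (i.val = 2 * t ∧ j.val = 2 * t + 1)) ∨
     ((j.val = 0 ∧ i.val ≠ 2 * t) ∨ (j.val % 2 = 1 ∧ i.val = j.val + 1 ∧ i.val ≤ 2 * t) ∨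
      (j.val = 2 * t ∧ i.val = 2 * t + 1))) := by
  rw [secondMinGraph, fromRel_adj, Ne, Fin.ext_iff]

theorem hasMinShape_minGraph (hn : 2 * t + 2 ≤ n) : HasMinShape (minGraph n t) := by
  refine ⟨⟨0, by omega⟩, fun v hv => ?_⟩
  rw [Ne, Fin.ext_iff] at hv
  have hv' : v.val ≠ 0 := hv
  refine ⟨minGraph_adj.2 ⟨hv'.symm, Or.inl (Or.inl rfl)⟩, ?_⟩
  -- The only possible neighbour besides `0` is the partner of `v` in its triangle.
  have hlt := v.isLt
  by_cases hodd : v.val % 2 = 1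
  · by_cases hlast : v.val + 1 < n
    · refine ncard_neighborSet_le_two (a := ⟨0, by omega⟩) (b := ⟨v.val + 1, hlast⟩) fun z hz => ?_
      rw [minGraph_adj] at hz
      simp only [Fin.ext_iff]
      omega
    · refine ncard_neighborSet_le_two (a := ⟨0, by omega⟩) (b := ⟨0, by omega⟩) fun z hz => ?_
      rw [minGraph_adj] at hz
      simp only [Fin.ext_iff]
      omega
  · refine ncard_neighborSet_le_two (a := ⟨0, by omega⟩) (b := ⟨v.val - 1, by omega⟩)
      fun z hz => ?_
    rw [minGraph_adj] at hz
    simp only [Fin.ext_iff]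
    omega

theorem minGraph_mem_cact (hn : 2 * t + 2 ≤ n) : minGraph n t ∈ Cact n t := by
  have : Nontrivial (Fin n) := Fin.nontrivial_iff_two_le.2 (by omega)
  have hconn : (minGraph n t).Connected := by
    refine connected_of_forall_reachable ⟨0, by omega⟩ fun v => ?_
    by_cases hv : v.val = 0
    · rw [show v = ⟨0, by omega⟩ from Fin.ext hv]
    · exact (minGraph_adj.2 ⟨fun h => hv h.symm, Or.inl (Or.inl rfl)⟩ :
        (minGraph n t).Adj ⟨0, by omega⟩ v).reachable
  have htri : ∀ i : Fin t, ∃ C : (minGraph n t).Subgraph, IsCycleSubgraph C ∧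
      (∀ x : Fin n, x ∈ C.verts ↔ x.val = 0 ∨ x.val = 2 * i + 1 ∨ x.val = 2 * i + 2) ∧
      ∀ x ∈ C.verts, ∀ y ∈ C.verts, (minGraph n t).Adj x y → C.Adj x y := by
    intro i
    have hi := i.isLt
    obtain ⟨C, hC, hverts, hadj⟩ := exists_triangle (G := minGraph n t) (c := ⟨0, by omega⟩)
      (a := ⟨2 * i + 1, by omega⟩) (b := ⟨2 * i + 2, by omega⟩)
      (by rw [minGraph_adj]; dsimp only; omega) (by rw [minGraph_adj]; dsimp only; omega)
      (by rw [minGraph_adj]; dsimp only; omega)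
    exact ⟨C, hC, fun x => by rw [hverts]; simp only [Fin.ext_iff], hadj⟩
  choose C hC hverts hadj using htri
  refine isCactus_and_numCycles_eq hconn ⟨0, by omega⟩
    (fun v => if v.val ≤ 2 * t then (v.val + 1) / 2 else v.val) ?_ C hC ?_ ?_
  · intro u v hu hv h
    rw [minGraph_adj] at h
    rw [Ne, Fin.ext_iff] at hu hv
    dsimp only at hu hv ⊢
    split_ifs <;> omega
  · intro i j hij
    have hmem : (⟨2 * i + 1, by omega⟩ : Fin n) ∈ (C j).verts := by
      rw [← hij, hverts]; simp
    rw [hverts] at hmem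
    dsimp only at hmem
    exact Fin.ext (by omega)
  · intro v hv
    rw [Ne, Fin.ext_iff] at hv
    dsimp only at hv
    by_cases hvt : v.val ≤ 2 * t
    · left
      have hcls : ∀ x : Fin n, (x = ⟨0, by omega⟩ ∨
          (if x.val ≤ 2 * t then (x.val + 1) / 2 else x.val)
            = if v.val ≤ 2 * t then (v.val + 1) / 2 else v.val) →
          x ∈ (C ⟨(v.val - 1) / 2, by omega⟩).verts := by
        intro x hx
        rw [Fin.ext_iff] at hx
        rw [hverts]
        dsimp only at hx ⊢
        split_ifs at hx <;> omega
      exact ⟨_, hcls, fun x y hx hy hxy => hadj _ x (hcls x hx) y (hcls y hy) hxy⟩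
    · right
      refine ⟨minGraph_adj.2 ⟨fun h => hv h.symm, Or.inl (Or.inl rfl)⟩, fun x hx hl => ?_⟩
      rw [Ne, Fin.ext_iff] at hx
      refine Fin.ext ?_
      dsimp only at hx hl
      split_ifs at hl <;> omega

theorem hasSecondMinShape_secondMinGraph (ht : 1 ≤ t) (hn : 2 * t + 2 ≤ n) :
    HasSecondMinShape (secondMinGraph n t) := by
  have hw : (secondMinGraph n t).neighborSet ⟨2 * t, by omega⟩
      = {⟨2 * t - 1, by omega⟩, ⟨2 * t + 1, by omega⟩} := by
    ext z
    rw [mem_neighborSet, secondMinGraph_adj]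
    simp only [Set.mem_insert_iff, Set.mem_singleton_iff, Fin.ext_iff]
    constructor
    · omega
    · intro h
      rcases h with h | h
      · exact ⟨by omega, Or.inr (Or.inr (Or.inl ⟨by omega, by omega, le_rfl⟩))⟩
      · exact ⟨by omega, Or.inl (Or.inr (Or.inr ⟨trivial, h⟩))⟩
  refine ⟨⟨0, by omega⟩, ⟨2 * t, by omega⟩, ?_, ?_, ?_, fun v hv hvw => ?_⟩
  · rw [Ne, Fin.ext_iff]; dsimp only; omega
  · rw [secondMinGraph_adj]; dsimp only; omega
  · rw [hw, Set.ncard_pair]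
    rw [Ne, Fin.ext_iff]; dsimp only; omega
  · rw [Ne, Fin.ext_iff] at hv hvw
    dsimp only at hv hvw
    refine ⟨by rw [secondMinGraph_adj]; dsimp only; omega, ?_⟩
    have hlt := v.isLt
    by_cases hodd : v.val % 2 = 1
    · by_cases hq : v.val = 2 * t + 1
      · refine ncard_neighborSet_le_two (a := ⟨0, by omega⟩) (b := ⟨2 * t, by omega⟩)
          fun z hz => ?_
        rw [secondMinGraph_adj] at hz
        simp only [Fin.ext_iff]
        omega
      by_cases hlast : v.val + 1 < n
      · refine ncard_neighborSet_le_two (a := ⟨0, by omega⟩) (b := ⟨v.val + 1, hlast⟩)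
          fun z hz => ?_
        rw [secondMinGraph_adj] at hz
        simp only [Fin.ext_iff]
        omega
      · refine ncard_neighborSet_le_two (a := ⟨0, by omega⟩) (b := ⟨0, by omega⟩) fun z hz => ?_
        rw [secondMinGraph_adj] at hz
        simp only [Fin.ext_iff]
        omega
    · refine ncard_neighborSet_le_two (a := ⟨0, by omega⟩) (b := ⟨v.val - 1, by omega⟩)
        fun z hz => ?_
      rw [secondMinGraph_adj] at hz
      simp only [Fin.ext_iff]
      omega

theorem secondMinGraph_mem_cact (ht : 1 ≤ t) (hn : 2 * t + 2 ≤ n) :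
    secondMinGraph n t ∈ Cact n t := by
  have : Nontrivial (Fin n) := Fin.nontrivial_iff_two_le.2 (by omega)
  have hconn : (secondMinGraph n t).Connected := by
    have h0 : ∀ v : Fin n, v.val ≠ 0 → v.val ≠ 2 * t →
        (secondMinGraph n t).Adj ⟨0, by omega⟩ v := by
      intro v h1 h2
      rw [secondMinGraph_adj]; dsimp only; omega
    refine connected_of_forall_reachable ⟨0, by omega⟩ fun v => ?_
    by_cases hv : v.val = 0
    · rw [show v = ⟨0, by omega⟩ from Fin.ext hv]
    by_cases hvw : v.val = 2 * t
    · refine (h0 ⟨2 * t + 1, by omega⟩ (by simp) (by simp)).reachable.trans (Adj.reachable ?_)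
      rw [secondMinGraph_adj]; dsimp only; omega
    · exact (h0 v hv hvw).reachable
  have hcyc : ∀ i : Fin t, ∃ C : (secondMinGraph n t).Subgraph, IsCycleSubgraph C ∧
      (∀ x : Fin n, x ∈ C.verts ↔ x.val = 0 ∨ x.val = 2 * i + 1 ∨ x.val = 2 * i + 2 ∨
        (i.val + 1 = t ∧ x.val = 2 * t + 1)) ∧
      ∀ x ∈ C.verts, ∀ y ∈ C.verts, (secondMinGraph n t).Adj x y → C.Adj x y := by
    intro i
    have hi := i.isLt
    by_cases hlast : i.val + 1 = t
    · obtain ⟨C, hC, hverts, hadj⟩ := exists_quadrangle (G := secondMinGraph n t)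
        (c := ⟨0, by omega⟩) (a := ⟨2 * i + 1, by omega⟩) (w := ⟨2 * i + 2, by omega⟩)
        (b := ⟨2 * t + 1, by omega⟩) (by rw [secondMinGraph_adj]; dsimp only; omega)
        (by rw [secondMinGraph_adj]; dsimp only; omega)
        (by rw [secondMinGraph_adj]; dsimp only; omega)
        (by rw [secondMinGraph_adj]; dsimp only; omega)
        (by rw [Ne, Fin.ext_iff]; dsimp only; omega)
        (by rw [Ne, Fin.ext_iff]; dsimp only; omega)
        (by rw [secondMinGraph_adj]; dsimp only; omega)
        (by rw [secondMinGraph_adj]; dsimp only; omega)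
      exact ⟨C, hC, fun x => by rw [hverts]; simp only [Fin.ext_iff, hlast, true_and], hadj⟩
    · obtain ⟨C, hC, hverts, hadj⟩ := exists_triangle (G := secondMinGraph n t)
        (c := ⟨0, by omega⟩) (a := ⟨2 * i + 1, by omega⟩) (b := ⟨2 * i + 2, by omega⟩)
        (by rw [secondMinGraph_adj]; dsimp only; omega)
        (by rw [secondMinGraph_adj]; dsimp only; omega)
        (by rw [secondMinGraph_adj]; dsimp only; omega)
      exact ⟨C, hC, fun x => by
        rw [hverts]; simp only [Fin.ext_iff, hlast, false_and, or_false], hadj⟩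
  choose C hC hverts hadj using hcyc
  refine isCactus_and_numCycles_eq hconn ⟨0, by omega⟩
    (fun v => if v.val ≤ 2 * t then (v.val + 1) / 2 else if v.val = 2 * t + 1 then t else v.val)
    ?_ C hC ?_ ?_
  · intro u v hu hv h
    rw [secondMinGraph_adj] at h
    rw [Ne, Fin.ext_iff] at hu hv
    dsimp only at hu hv ⊢
    split_ifs <;> omega
  · intro i j hij
    have hmem : (⟨2 * i + 1, by omega⟩ : Fin n) ∈ (C j).verts := by
      rw [← hij, hverts]; simp
    rw [hverts] at hmem
    dsimp only at hmem
    exact Fin.ext (by omega)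
  · intro v hv
    rw [Ne, Fin.ext_iff] at hv
    dsimp only at hv
    by_cases hvt : v.val ≤ 2 * t + 1
    · left
      have hcls : ∃ i : Fin t, ∀ x : Fin n, (x = ⟨0, by omega⟩ ∨
          (if x.val ≤ 2 * t then (x.val + 1) / 2 else if x.val = 2 * t + 1 then t else x.val)
            = if v.val ≤ 2 * t then (v.val + 1) / 2 else if v.val = 2 * t + 1 then t else v.val) →
          x ∈ (C i).verts := by
        by_cases hv2 : v.val ≤ 2 * t
        · refine ⟨⟨(v.val - 1) / 2, by omega⟩, fun x hx => ?_⟩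
          rw [Fin.ext_iff] at hx
          rw [hverts]
          dsimp only at hx ⊢
          split_ifs at hx <;> omega
        · refine ⟨⟨t - 1, by omega⟩, fun x hx => ?_⟩
          rw [Fin.ext_iff] at hx
          rw [hverts]
          dsimp only at hx ⊢
          split_ifs at hx <;> omega
      obtain ⟨i, hi⟩ := hcls
      exact ⟨i, hi, fun x y hx hy hxy => hadj i x (hi x hx) y (hi y hy) hxy⟩
    · right
      refine ⟨by rw [secondMinGraph_adj]; dsimp only; omega, fun x hx hl => ?_⟩
      rw [Ne, Fin.ext_iff] at hx
      refine Fin.ext ?_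
      dsimp only at hx hl
      split_ifs at hl <;> omega

end Concrete

end CactusResistance

theorem theorem4p1 (n t : ℕ) (hn : 7 ≤ n) (ht : 1 ≤ t) (hnt : 2 * t + 2 ≤ n) :
    CactusResistance.minGraph n t ∈ CactusResistance.Cact n t ∧
    CactusResistance.secondMinGraph n t ∈ CactusResistance.Cact n t ∧
    CactusResistance.degreeResistanceDistance (CactusResistance.minGraph n t) <
      CactusResistance.degreeResistanceDistance (CactusResistance.secondMinGraph n t) ∧
    ∀ G ∈ CactusResistance.Cact n t, ¬ Nonempty (G ≃g CactusResistance.minGraph n t) →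
      CactusResistance.degreeResistanceDistance (CactusResistance.secondMinGraph n t) ≤
        CactusResistance.degreeResistanceDistance G ∧
      (CactusResistance.degreeResistanceDistance G =
          CactusResistance.degreeResistanceDistance (CactusResistance.secondMinGraph n t) ↔
        Nonempty (G ≃g CactusResistance.secondMinGraph n t)) := by
  open CactusResistance in
  have hmin := minGraph_mem_cact hnt
  have hsec := secondMinGraph_mem_cact ht hnt
  have hval := (hasMinShape_minGraph hnt).degreeResistanceDistance_eq hmin.1
  have hsecond : ∀ G ∈ Cact n t, HasSecondMinShape G →
      degreeResistanceDistance G = minValue n t + gap n t := by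
    intro G hG hs
    have := hs.degreeResistanceDistance_eq hG.1 (by simpa using hn)
    rwa [hG.2, Fintype.card_fin] at this
  have hval' := hsecond _ hsec (hasSecondMinShape_secondMinGraph ht hnt)
  rw [hmin.2, Fintype.card_fin] at hval
  have hgap : 0 < gap n t := gap_pos (by exact_mod_cast hn) (by exact_mod_cast ht)
  refine ⟨hmin, hsec, by rw [hval, hval']; linarith, fun G hG hiso => ?_⟩
  have hedges : G.edgeSet.ncard + 1 = n + t := by
    have := hG.1.ncard_edgeSet
    rwa [hG.2, Fintype.card_fin] at this
  have hshape : ¬ HasMinShape G := fun h => hiso (h.nonempty_iso (by omega) hedges)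
  have hle := le_degreeResistanceDistance hG.1 (by simpa using hn) (by rw [hG.2]; exact ht)
    (by rw [hG.2, Fintype.card_fin]; omega) hshape
  rw [hG.2, Fintype.card_fin] at hle
  rw [hval']
  refine ⟨hle.1, fun h => (hle.2 h).nonempty_iso ht hnt hedges, fun ⟨e⟩ => ?_⟩
  exact hsecond G hG ((hasSecondMinShape_secondMinGraph ht hnt).of_iso e)
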